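/- Let $K$ be an algebraically closed field of characteristic $0$, let $N$ be a lattice (a free abelian group of finite rank), let $\Sigma$ be a fan in $N_{\mathbb R}=N\otimes_{\mathbb Z}\mathbb R$, that is, a finite nonempty collection of strongly convex rational polyhedral cones which is closed under taking faces and in which any two cones intersect in a common face, and let $X(\Sigma)$ be the associated toric variety over $K$. Suppose that $X(\Sigma)$ is non-degenerate, that is, that the support $|\Sigma|=\bigcup_{\sigma\in\Sigma}\sigma$ spans the real vector space $N_{\mathbb R}$ (equivalently, $X(\Sigma)$ has no torus factors). Let $N_1\subseteq N$ be the sublattice spanned by the primitive generators of the rays (one-dimensional cones) in $\Sigma(1)$, and let $\operatorname{Cl}(X(\Sigma))$ be the group of Weil divisors on $X(\Sigma)$ modulo principal divisors. Then there is an isomorphism of abelian groups $$\operatorname{Tors}\bigl(\operatorname{Cl}(X(\Sigma))\bigr)\;\cong\; N/N_1,$$ where $\operatorname{Tors}$ denotes the torsion subgroup. -/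

import Mathlib

open AlgebraicGeometry CategoryTheory

open scoped TensorProduct

universe u

namespace Toric

section Cones

variable {N : Type u} [AddCommGroup N]

/-- The real vector space `N_ℝ = ℝ ⊗ N` of a lattice `N`. -/
abbrev RealSpace (N : Type u) [AddCommGroup N] : Type u := ℝ ⊗[ℤ] N

/-- The image of a lattice vector in `N_ℝ`. -/
def toReal (v : N) : RealSpace N := (1 : ℝ) ⊗ₜ[ℤ] v

/-- The real linear form on `N_ℝ` given by an element `m` of the dual lattice
`M = Hom(N, ℤ)`. -/
noncomputable def pairing (m : Module.Dual ℤ N) : RealSpace N →ₗ[ℝ] ℝ :=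
  Module.Dual.baseChange ℝ m

@[simp]
lemma pairing_toReal (m : Module.Dual ℤ N) (v : N) : pairing m (toReal v) = (m v : ℝ) := by
  simp [pairing, toReal]

lemma pairing_add (m m' : Module.Dual ℤ N) : pairing (m + m') = pairing m + pairing m' := by
  simp [pairing]

lemma pairing_zero : pairing (0 : Module.Dual ℤ N) = 0 := by
  simp [pairing]

/-- A cone in `N_ℝ` is rational polyhedral if it is generated by finitely many lattice
vectors. -/
def IsRationalPolyhedral (σ : PointedCone ℝ (RealSpace N)) : Prop :=
  ∃ s : Finset N, σ = PointedCone.hull ℝ (toReal '' (s : Set N))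

/-- `τ` is a face of `σ`: it is cut out in `σ` by `m^⊥` for some `m ∈ σ^∨ ∩ M`. -/
def IsFace (τ σ : PointedCone ℝ (RealSpace N)) : Prop :=
  ∃ m : Module.Dual ℤ N, (∀ x ∈ σ, 0 ≤ pairing m x) ∧ ∀ x, x ∈ τ ↔ x ∈ σ ∧ pairing m x = 0

/-- The semigroup `S_σ = σ^∨ ∩ M`. -/
def dualMonoid (σ : PointedCone ℝ (RealSpace N)) : AddSubmonoid (Module.Dual ℤ N) where
  carrier := {m | ∀ x ∈ σ, 0 ≤ pairing m x}
  zero_mem' := by simp [pairing_zero]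
  add_mem' := by
    intro a b ha hb x hx
    rw [pairing_add]
    exact add_nonneg (ha x hx) (hb x hx)

lemma dualMonoid_anti {σ τ : PointedCone ℝ (RealSpace N)} (h : τ ≤ σ) :
    dualMonoid σ ≤ dualMonoid τ := fun _ hm x hx => hm x (h hx)

lemma mem_dualMonoid_hull (s : Set N) (m : Module.Dual ℤ N) :
    m ∈ dualMonoid (PointedCone.hull ℝ (toReal '' s)) ↔ ∀ v ∈ s, 0 ≤ m v := by
  constructor
  · intro h v hv
    have := h (toReal v) (Submodule.subset_span ⟨v, hv, rfl⟩)
    simpa using this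
  · intro h x hx
    induction hx using Submodule.span_induction with
    | mem x hx =>
      obtain ⟨v, hv, rfl⟩ := hx
      simpa using h v hv
    | zero => simp
    | add x y _ _ hx hy => rw [map_add]; exact add_nonneg hx hy
    | smul a x _ hx =>
      have : a • x = (a : ℝ) • x := rfl
      rw [this, map_smul]
      exact mul_nonneg a.2 hx

/-- Gordan's lemma. -/
lemma dualMonoid_fg [Module.Free ℤ N] [Module.Finite ℤ N] {σ : PointedCone ℝ (RealSpace N)}
    (hσ : IsRationalPolyhedral σ) : AddMonoid.FG (dualMonoid σ) := by
  obtain ⟨s, rfl⟩ := hσ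
  let ι := Module.Free.ChooseBasisIndex ℤ (Module.Dual ℤ N)
  let b := Module.Free.chooseBasis ℤ (Module.Dual ℤ N)
  let φ : (ι ⊕ ι ⊕ s → ℕ) →+ Module.Dual ℤ N :=
    { toFun := fun p => ∑ i, ((p (.inl i) : ℤ) - p (.inr (.inl i))) • b i
      map_zero' := by simp
      map_add' := by
        intro p q
        rw [← Finset.sum_add_distrib]
        refine Finset.sum_congr rfl fun i _ => ?_
        rw [← add_smul]
        congr 1
        simp only [Pi.add_apply, Nat.cast_add]
        ring }
  let T : AddSubmonoid (ι ⊕ ι ⊕ s → ℕ) :=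
    { carrier := {p | ∀ v : s, φ p v = (p (.inr (.inr v)) : ℤ)}
      zero_mem' := by intro v; rw [map_zero]; simp
      add_mem' := by
        intro p q hp hq v
        rw [map_add, LinearMap.add_apply, hp v, hq v]
        simp }
  have hT : T.FG := AddSubmonoid.fg_of_subtractive (by
    intro x hx y hxy v
    have h1 := hx v
    have h2 := hxy v
    rw [map_add, LinearMap.add_apply, h1] at h2
    simpa using h2)
  have hmap : T.map φ = dualMonoid (PointedCone.hull ℝ (toReal '' (s : Set N))) := by
    ext m
    rw [mem_dualMonoid_hull]
    constructor
    · rintro ⟨p, hp, rfl⟩ v hv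
      rw [hp ⟨v, hv⟩]
      positivity
    · intro h
      have hφ : ∀ p : ι ⊕ ι ⊕ s → ℕ, (∀ i, ((p (.inl i) : ℤ) - p (.inr (.inl i))) = b.repr m i) →
          φ p = m := by
        intro p hp
        conv_rhs => rw [← b.sum_repr m]
        exact Finset.sum_congr rfl fun i _ => by rw [hp i]
      have hm : φ (Sum.elim (fun i => (b.repr m i).toNat)
          (Sum.elim (fun i => (-(b.repr m i)).toNat) fun v => (m v).toNat)) = m := by
        apply hφ
        intro i
        simp only [Sum.elim_inl, Sum.elim_inr]
        omega
      refine ⟨_, ?_, hm⟩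
      intro v
      rw [hm]
      simpa using h v v.2
  rw [← hmap]
  exact (AddMonoid.fg_iff_addSubmonoid_fg _).mpr (hT.map φ)

/-- Any `m' ∈ S_τ`, `τ = σ ∩ m^⊥`, is moved into `S_σ` by adding a multiple of `m`. -/
lemma exists_nsmul_add_mem {σ τ : PointedCone ℝ (RealSpace N)} (hσ : IsRationalPolyhedral σ)
    {m : Module.Dual ℤ N} (hm : m ∈ dualMonoid σ)
    (hτ : ∀ x, x ∈ τ ↔ x ∈ σ ∧ pairing m x = 0) {m' : Module.Dual ℤ N} (hm' : m' ∈ dualMonoid τ) :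
    ∃ n₀ : ℕ, ∀ n, n₀ ≤ n → n • m + m' ∈ dualMonoid σ := by
  obtain ⟨s, rfl⟩ := hσ
  refine ⟨∑ v ∈ s, (m' v).natAbs, fun n hn => ?_⟩
  rw [mem_dualMonoid_hull] at hm ⊢
  intro v hv
  have h1 : 0 ≤ m v := hm v hv
  have h3 : (m' v).natAbs ≤ n :=
    (Finset.single_le_sum (f := fun v => (m' v).natAbs) (fun _ _ => Nat.zero_le _) hv).trans hn
  simp only [LinearMap.add_apply, LinearMap.smul_apply, nsmul_eq_mul]
  rcases h1.eq_or_lt with h | h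
  · have hvτ : toReal v ∈ τ := (hτ _).2 ⟨Submodule.subset_span ⟨v, hv, rfl⟩, by simp [← h]⟩
    have := hm' _ hvτ
    rw [pairing_toReal] at this
    have : 0 ≤ m' v := by exact_mod_cast this
    rw [← h]
    simpa using this
  · have : (n : ℤ) * 1 ≤ n * m v := by gcongr; omega
    omega

end Cones

/-- A fan in `N_ℝ`: a finite nonempty collection of strongly convex rational polyhedral cones,
closed under taking faces, in which any two cones meet in a common face. -/
structure Fan (N : Type u) [AddCommGroup N] where
  cones : Set (PointedCone ℝ (RealSpace N))
  finite : cones.Finite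
  nonempty : cones.Nonempty
  rational : ∀ σ ∈ cones, IsRationalPolyhedral σ
  stronglyConvex : ∀ σ ∈ cones, ∀ x ∈ σ, -x ∈ σ → x = 0
  face_mem : ∀ σ ∈ cones, ∀ τ, IsFace τ σ → τ ∈ cones
  inf_isFace : ∀ σ ∈ cones, ∀ τ ∈ cones, IsFace (σ ⊓ τ) σ ∧ IsFace (σ ⊓ τ) τ

namespace Fan

variable {N : Type u} [AddCommGroup N]

/-- The set `Σ(1)` of rays, i.e. one-dimensional cones, of the fan. -/
def rays (F : Fan N) : Set (PointedCone ℝ (RealSpace N)) :=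
  {ρ ∈ F.cones | Module.finrank ℝ (Submodule.span ℝ (ρ : Set (RealSpace N))) = 1}

/-- The support `|Σ|` of the fan. -/
def support (F : Fan N) : Set (RealSpace N) := ⋃ σ ∈ F.cones, (σ : Set (RealSpace N))

/-- The fan, or its toric variety, is non-degenerate (the variety has no torus factors) if the
support of the fan spans `N_ℝ`. -/
def IsNondegenerate (F : Fan N) : Prop := Submodule.span ℝ F.support = ⊤

end Fan

/-- A lattice vector is primitive if it is not a proper multiple of another lattice vector;
in particular it is nonzero. -/
def IsPrimitive {N : Type u} [AddCommGroup N] (v : N) : Prop :=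
  ∀ (k : ℤ) (w : N), v = k • w → IsUnit k

/-- `v` is the primitive generator of the ray `ρ`. -/
def IsPrimitiveGenerator {N : Type u} [AddCommGroup N] (v : N)
    (ρ : PointedCone ℝ (RealSpace N)) : Prop :=
  IsPrimitive v ∧ ρ = PointedCone.hull ℝ {toReal v}

/-- The sublattice `N₁ ⊆ N` spanned by the primitive generators of the rays in `Σ(1)`. -/
def Fan.raySublattice {N : Type u} [AddCommGroup N] (F : Fan N) : Submodule ℤ N :=
  Submodule.span ℤ {v | ∃ ρ ∈ F.rays, IsPrimitiveGenerator v ρ}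

section Variety

variable (K : Type u) [Field K] {N : Type u} [AddCommGroup N]

/-- The semigroup algebra `K[S_σ]`. -/
abbrev coordRing (σ : PointedCone ℝ (RealSpace N)) : Type u := AddMonoidAlgebra K (dualMonoid σ)

/-- For `τ ⊆ σ`, the ring homomorphism `K[S_σ] → K[S_τ]` induced by `S_σ ⊆ S_τ`. -/
noncomputable def coordMap {σ τ : PointedCone ℝ (RealSpace N)} (h : τ ≤ σ) :
    coordRing K σ →+* coordRing K τ :=
  AddMonoidAlgebra.mapDomainRingHom K (AddSubmonoid.inclusion (dualMonoid_anti h))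

lemma coordMap_single {σ τ : PointedCone ℝ (RealSpace N)} (h : τ ≤ σ) (m : dualMonoid σ) (a : K) :
    coordMap K h (.single m a) = .single (AddSubmonoid.inclusion (dualMonoid_anti h) m) a := by
  simp [coordMap]

lemma coordMap_injective {σ τ : PointedCone ℝ (RealSpace N)} (h : τ ≤ σ) :
    Function.Injective (coordMap K h) :=
  AddMonoidAlgebra.mapDomain_injective (AddSubmonoid.inclusion_injective _)

instance coordRing_isDomain [Module.Free ℤ N] [Module.Finite ℤ N]
    (σ : PointedCone ℝ (RealSpace N)) : IsDomain (coordRing K σ) := by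
  let b := Module.Free.chooseBasis ℤ (Module.Dual ℤ N)
  have : TwoUniqueSums (dualMonoid σ) :=
    .of_injective_addHom
      (b.repr.toLinearMap.toAddMonoidHom.comp (dualMonoid σ).subtype).toAddHom
      (b.repr.injective.comp Subtype.val_injective) inferInstance
  infer_instance

lemma coordRing_isNoetherianRing [Module.Free ℤ N] [Module.Finite ℤ N]
    {σ : PointedCone ℝ (RealSpace N)} (hσ : IsRationalPolyhedral σ) :
    IsNoetherianRing (coordRing K σ) := by
  have := dualMonoid_fg hσ
  exact Algebra.FiniteType.isNoetherianRing K _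

/-- For a face `τ = σ ∩ m^⊥` of `σ`, the ring `K[S_τ]` is the localization of `K[S_σ]` at the
character `χ^m`. -/
lemma isLocalization_coordMap {σ τ : PointedCone ℝ (RealSpace N)} (hσ : IsRationalPolyhedral σ)
    (h : τ ≤ σ) {m : Module.Dual ℤ N} (hm : m ∈ dualMonoid σ)
    (hτ : ∀ x, x ∈ τ ↔ x ∈ σ ∧ pairing m x = 0) :
    let _ := (coordMap K h).toAlgebra
    IsLocalization.Away (.single ⟨m, hm⟩ 1 : coordRing K σ) (coordRing K τ) := by
  let _ := (coordMap K h).toAlgebra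
  have hmap : ∀ z, algebraMap (coordRing K σ) (coordRing K τ) z = coordMap K h z := fun _ => rfl
  have hneg : -m ∈ dualMonoid τ := by
    intro x hx
    have h1 : pairing (-m) x = -pairing m x := by simp [pairing]
    rw [h1, ((hτ x).1 hx).2, neg_zero]
  refine (isLocalization_iff _ _).mpr ⟨?_, ?_, ?_⟩
  · rintro ⟨_, n, rfl⟩
    rw [map_pow]
    refine IsUnit.pow n (IsUnit.of_mul_eq_one (.single ⟨-m, hneg⟩ 1) ?_)
    rw [hmap, coordMap_single, AddMonoidAlgebra.single_mul_single, AddMonoidAlgebra.one_def]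
    congr 1
    · ext1
      simp
    · simp
  · have key : ∀ z : coordRing K τ, ∃ n₀ : ℕ, ∀ n, n₀ ≤ n → ∃ x : coordRing K σ,
        z * coordMap K h (.single ⟨m, hm⟩ 1 ^ n) = coordMap K h x := by
      intro z
      induction z using AddMonoidAlgebra.induction_linear with
      | zero => exact ⟨0, fun n _ => ⟨0, by simp⟩⟩
      | add f g hf hg =>
        obtain ⟨a, ha⟩ := hf
        obtain ⟨b, hb⟩ := hg
        refine ⟨max a b, fun n hn => ?_⟩
        obtain ⟨x, hx⟩ := ha n (le_of_max_le_left hn)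
        obtain ⟨y, hy⟩ := hb n (le_of_max_le_right hn)
        exact ⟨x + y, by rw [add_mul, hx, hy, map_add]⟩
      | single m' c =>
        obtain ⟨n₀, hn₀⟩ := exists_nsmul_add_mem hσ hm hτ m'.2
        refine ⟨n₀, fun n hn => ⟨.single ⟨_, hn₀ n hn⟩ c, ?_⟩⟩
        rw [AddMonoidAlgebra.single_pow, coordMap_single, coordMap_single,
          AddMonoidAlgebra.single_mul_single]
        congr 1
        · ext1
          simp [add_comm]
        · simp
    intro z
    obtain ⟨n, hn⟩ := key z
    obtain ⟨x, hx⟩ := hn n le_rfl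
    exact ⟨(x, ⟨_, n, rfl⟩), hx⟩
  · intro x y hxy
    exact ⟨1, by rw [coordMap_injective K h hxy]⟩

/-- The affine toric variety `U_σ = Spec K[S_σ]`. -/
noncomputable abbrev affineToric (σ : PointedCone ℝ (RealSpace N)) : Scheme.{u} :=
  Spec (.of (coordRing K σ))

/-- The morphism `U_τ ⟶ U_σ` for `τ ⊆ σ`. -/
noncomputable def affineToricMap {σ τ : PointedCone ℝ (RealSpace N)} (h : τ ≤ σ) :
    affineToric K τ ⟶ affineToric K σ :=
  Spec.map (CommRingCat.ofHom (coordMap K h))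

lemma affineToricMap_isOpenImmersion {σ τ : PointedCone ℝ (RealSpace N)}
    (hσ : IsRationalPolyhedral σ) (h : τ ≤ σ) (hτ : IsFace τ σ) :
    IsOpenImmersion (affineToricMap K h) := by
  obtain ⟨m, hm, hτ⟩ := hτ
  let _ := (coordMap K h).toAlgebra
  have := isLocalization_coordMap K hσ h hm hτ
  exact IsOpenImmersion.of_isLocalization (.single ⟨m, hm⟩ 1 : coordRing K σ)

lemma range_affineToricMap {σ τ : PointedCone ℝ (RealSpace N)}
    (hσ : IsRationalPolyhedral σ) (h : τ ≤ σ) {m : Module.Dual ℤ N} (hm : m ∈ dualMonoid σ)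
    (hτ : ∀ x, x ∈ τ ↔ x ∈ σ ∧ pairing m x = 0) :
    Set.range (affineToricMap K h) =
      (PrimeSpectrum.basicOpen (.single ⟨m, hm⟩ 1 : coordRing K σ) :
        Set (PrimeSpectrum (coordRing K σ))) := by
  let _ := (coordMap K h).toAlgebra
  have := isLocalization_coordMap K hσ h hm hτ
  exact PrimeSpectrum.localization_away_comap_range (coordRing K τ)
    (.single ⟨m, hm⟩ 1 : coordRing K σ)

end Variety

namespace Fan

variable {N : Type u} [AddCommGroup N] (F : Fan N) (K : Type u) [Field K]

/-- The diagram of the affine toric varieties `U_σ`, `σ ∈ Σ`, and of the open immersions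
`U_τ ⟶ U_σ` for the faces `τ` of `σ`; for cones of a fan, `τ ⊆ σ` if and only if `τ` is a face
of `σ`. -/
noncomputable def diagram : F.cones ⥤ Scheme.{u} where
  obj σ := affineToric K σ.1
  map f := affineToricMap K (leOfHom f)
  map_id σ := by
    have : coordMap K (le_refl σ.1) = RingHom.id _ := AddMonoidAlgebra.mapDomainRingHom_id
    simp only [affineToricMap, affineToric]
    rw [this]
    simp
  map_comp f g := by
    simp only [affineToricMap, affineToric]
    rw [← Spec.map_comp, ← CommRingCat.ofHom_comp]
    congr 2
    exact AddMonoidAlgebra.mapDomainRingHom_comp (R := K)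
      (AddSubmonoid.inclusion (dualMonoid_anti (leOfHom f)))
      (AddSubmonoid.inclusion (dualMonoid_anti (leOfHom g)))

lemma isFace_of_le {σ τ : PointedCone ℝ (RealSpace N)} (hσ : σ ∈ F.cones) (hτ : τ ∈ F.cones)
    (h : τ ≤ σ) : IsFace τ σ := by
  have := (F.inf_isFace σ hσ τ hτ).1
  rwa [inf_eq_right.mpr h] at this

instance {σ τ : F.cones} (f : τ ⟶ σ) : IsOpenImmersion ((F.diagram K).map f) :=
  affineToricMap_isOpenImmersion K (F.rational _ σ.2) _ (F.isFace_of_le σ.2 τ.2 (leOfHom f))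

instance : (F.diagram K ⋙ Scheme.forget).IsLocallyDirected where
  cond {i j k} fi fj xi xj hx := by
    obtain ⟨mi, hmi, hi⟩ := F.isFace_of_le k.2 i.2 (leOfHom fi)
    obtain ⟨mj, hmj, hj⟩ := F.isFace_of_le k.2 j.2 (leOfHom fj)
    replace hx : affineToricMap K (leOfHom fi) xi = affineToricMap K (leOfHom fj) xj := hx
    let l : F.cones := ⟨i.1 ⊓ j.1, F.face_mem _ i.2 _ (F.inf_isFace _ i.2 _ j.2).1⟩
    have hli : l ≤ i := inf_le_left (a := i.1)
    have hlj : l ≤ j := inf_le_right (a := i.1)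
    have hlk : l ≤ k := hli.trans (leOfHom fi)
    have hl : ∀ x, x ∈ l.1 ↔ x ∈ k.1 ∧ pairing (mi + mj) x = 0 := by
      intro x
      rw [pairing_add, LinearMap.add_apply]
      constructor
      · intro hx
        have h1 := (hi x).1 hx.1
        have h2 := (hj x).1 hx.2
        exact ⟨h1.1, by rw [h1.2, h2.2, add_zero]⟩
      · rintro ⟨h1, h2⟩
        have h3 := hmi x h1
        have h4 := hmj x h1
        exact ⟨(hi x).2 ⟨h1, by linarith⟩, (hj x).2 ⟨h1, by linarith⟩⟩
    have hmem : affineToricMap K (leOfHom fi) xi ∈ Set.range (affineToricMap K (show l.1 ≤ k.1 from hlk)) := by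
      rw [range_affineToricMap K (F.rational _ k.2) _ (add_mem hmi hmj) hl]
      have h1 : affineToricMap K (leOfHom fi) xi ∈ Set.range (affineToricMap K (leOfHom fi)) :=
        ⟨_, rfl⟩
      have h2 : affineToricMap K (leOfHom fi) xi ∈ Set.range (affineToricMap K (leOfHom fj)) :=
        ⟨_, hx.symm⟩
      rw [range_affineToricMap K (F.rational _ k.2) _ hmi hi] at h1
      rw [range_affineToricMap K (F.rational _ k.2) _ hmj hj] at h2
      have h3 : (.single ⟨mi + mj, add_mem hmi hmj⟩ 1 : coordRing K k.1) =
          .single ⟨mi, hmi⟩ 1 * .single ⟨mj, hmj⟩ 1 := by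
        rw [AddMonoidAlgebra.single_mul_single, mul_one]
        rfl
      rw [h3, PrimeSpectrum.basicOpen_mul]
      exact ⟨h1, h2⟩
    obtain ⟨x, hx'⟩ := hmem
    refine ⟨l, homOfLE hli, homOfLE hlj, x, ?_, ?_⟩
    · apply ((F.diagram K).map fi).isOpenEmbedding.injective
      refine Eq.trans ?_ hx'
      exact congr($((F.diagram K).map_comp (homOfLE hli) fi) x).symm
    · apply ((F.diagram K).map fj).isOpenEmbedding.injective
      refine Eq.trans ?_ (hx'.trans hx)
      exact congr($((F.diagram K).map_comp (homOfLE hlj) fj) x).symm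

/-- The toric variety `X(Σ)` over `K`: the scheme obtained by gluing the affine toric varieties
`U_σ`, `σ ∈ Σ`, along the open subschemes `U_{σ ∩ τ}`. -/
noncomputable def toricVariety : Scheme.{u} := Limits.colimit (F.diagram K)

/-- The open immersion `U_σ ⟶ X(Σ)`. -/
noncomputable def chart (σ : F.cones) : affineToric K σ.1 ⟶ F.toricVariety K :=
  Limits.colimit.ι (F.diagram K) σ

instance (σ : F.cones) : IsOpenImmersion (F.chart K σ) :=
  inferInstanceAs (IsOpenImmersion (Limits.colimit.ι (F.diagram K) σ))

lemma chart_comp {σ τ : F.cones} (h : τ ≤ σ) :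
    affineToricMap K h ≫ F.chart K σ = F.chart K τ :=
  Limits.colimit.w (F.diagram K) (homOfLE h)

lemma exists_chart_eq (x : F.toricVariety K) : ∃ (σ : F.cones) (y : affineToric K σ.1),
    F.chart K σ y = x :=
  Scheme.IsLocallyDirected.ι_jointly_surjective (F.diagram K) x

lemma exists_least : ∃ o : F.cones, ∀ σ : F.cones, o ≤ σ := by
  obtain ⟨o, ho⟩ := F.finite.exists_minimal F.nonempty
  refine ⟨⟨o, ho.1⟩, fun σ => ?_⟩
  have h1 := ho.2 (F.face_mem _ ho.1 _ (F.inf_isFace _ ho.1 _ σ.2).1) inf_le_left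
  exact h1.trans inf_le_right

variable [Module.Free ℤ N] [Module.Finite ℤ N]

instance (σ : F.cones) : IsNoetherianRing (coordRing K σ.1) :=
  coordRing_isNoetherianRing K (F.rational _ σ.2)

/-- The affine open cover of `X(Σ)` by the charts `U_σ`. -/
noncomputable def cover : (F.toricVariety K).OpenCover :=
  Scheme.IsLocallyDirected.openCover (F.diagram K)

instance toricVariety_isIntegral : IsIntegral (F.toricVariety K) := by
  have hred : ∀ i, IsReduced ((F.cover K).X i) := fun i =>
    inferInstanceAs (IsReduced (affineToric K i.1))
  have : IsReduced (F.toricVariety K) := IsReduced.of_openCover _ (F.cover K)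
  obtain ⟨o, ho⟩ := F.exists_least
  let η : F.toricVariety K := F.chart K o (genericPoint (affineToric K o.1))
  have hη : closure {η} = Set.univ := by
    refine Set.eq_univ_of_forall fun x => ?_
    obtain ⟨σ, y, rfl⟩ := F.exists_chart_eq K x
    rw [← specializes_iff_mem_closure]
    have : η = F.chart K σ (affineToricMap K (ho σ) (genericPoint (affineToric K o.1))) :=
      congr($(F.chart_comp K (ho σ)) (genericPoint (affineToric K o.1))).symm
    rw [this]
    refine Specializes.map ?_ (F.chart K σ).continuous
    have h := affineToricMap_isOpenImmersion K (F.rational _ σ.2) (ho σ)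
      (F.isFace_of_le σ.2 o.2 (ho σ))
    rw [genericPoint_eq_of_isOpenImmersion]
    exact genericPoint_specializes _
  have : IrreducibleSpace (F.toricVariety K) :=
    by
    rw [irreducibleSpace_def, Set.top_eq_univ, ← hη]
    exact isIrreducible_singleton.closure
  exact isIntegral_of_irreducibleSpace_of_isReduced _

instance toricVariety_isNoetherian : IsNoetherian (F.toricVariety K) := by
  have : Finite (F.cover K).I₀ := F.finite.to_subtype
  have : ∀ i, IsAffine ((F.cover K).X i) := fun i =>
    inferInstanceAs (IsAffine (affineToric K i.1))
  have : ∀ i, IsNoetherian ((F.cover K).X i) := fun (i : F.cones) =>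
    inferInstanceAs (IsNoetherian (affineToric K i.1))
  exact (isNoetherian_iff_of_finite_affine_openCover (𝒰 := F.cover K)).mpr fun i =>
    IsLocallyNoetherian.component_noetherian ⟨⊤, isAffineOpen_top _⟩

end Fan

/-- The group of Weil divisors of a Noetherian integral scheme: the free abelian group on the
prime divisors, which are identified with their generic points, the points of codimension one. -/
abbrev WeilDivisor (X : Scheme.{u}) : Type u := {x : X // Order.coheight x = 1} →₀ ℤ

lemma ord_one (X : Scheme.{u}) [IsIntegral X] [IsNoetherian X] (x : X) :
    X.ord (1 : X.functionField) x = 0 := by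
  have h := Scheme.ord_mul (x := x) (one_ne_zero (α := X.functionField)) one_ne_zero
  rw [mul_one] at h
  omega

/-- The subgroup of principal divisors `div f = ∑ ord_D(f) D`, for `f` a nonzero rational
function. -/
def principalDivisors (X : Scheme.{u}) [IsIntegral X] [IsNoetherian X] :
    AddSubgroup (WeilDivisor X) where
  carrier := {D | ∃ f : X.functionField, f ≠ 0 ∧ ∀ x, D x = X.ord f x.1}
  zero_mem' := ⟨1, one_ne_zero, fun x => by rw [ord_one, Finsupp.zero_apply]⟩
  add_mem' := by
    rintro D E ⟨f, hf, hD⟩ ⟨g, hg, hE⟩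
    refine ⟨f * g, mul_ne_zero hf hg, fun x => ?_⟩
    rw [Finsupp.add_apply, hD, hE, Scheme.ord_mul hf hg]
  neg_mem' := by
    rintro D ⟨f, hf, hD⟩
    refine ⟨f⁻¹, inv_ne_zero hf, fun x => ?_⟩
    have h := Scheme.ord_mul (x := x.1) hf (inv_ne_zero hf)
    rw [mul_inv_cancel₀ hf, ord_one] at h
    rw [Finsupp.neg_apply, hD]
    omega

/-- The divisor class group `Cl(X)`. -/
abbrev DivisorClassGroup (X : Scheme.{u}) [IsIntegral X] [IsNoetherian X] : Type u :=
  WeilDivisor X ⧸ principalDivisors X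

end Toric

/-! Write M for the dual lattice of N and V for the set of primitive ray generators. The theorem
follows from the exact sequence M → ℤ^V → Cl(X(Σ)) → 0, whose first map sends m to the values m(v) =
ord of χ^m along D_v, followed by a computation with lattices.

Exactness is geometric. Every prime divisor either meets the torus or is some D_v
(`exists_chart_or_rayPoint`). The coordinate ring K[M] of the torus is a UFD, so any divisor can be
moved off the torus by a principal divisor (`exists_ord_eq_on_torus`); hence ℤ^V surjects onto Cl. A
relation among the D_v is the divisor of a function with neither zeros nor poles on the torus. Such
a function is a constant times a character (`exists_eq_character`), and χ^m has divisor ∑ m(v) D_v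
(`ord_character_rayPoint`).

For the torsion, non-degeneracy says that a form vanishing on all ray generators is zero
(`eq_zero_of_forall_ray`), so N₁ has finite index in N. A tuple c represents a torsion class exactly
when some nonzero multiple of it comes from M, that is, when c is the restriction to the generators
of an integral form on N₁. Thus the torsion is N₁* modulo M, or Ext¹(N/N₁, ℤ). Adapted bases
identify this, non-canonically, with N/N₁ (`nonempty_torsion_addEquiv`). -/

namespace Toric

/-! ### Primitive vectors and duality in a lattice -/

section Lattice

variable {N : Type u} [AddCommGroup N]

lemma toReal_add (v w : N) : toReal (v + w) = toReal v + toReal w := TensorProduct.tmul_add _ _ _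

lemma toReal_zsmul (k : ℤ) (v : N) : toReal (k • v) = (k : ℝ) • toReal v := by
  simp [toReal, TensorProduct.smul_tmul']

lemma toReal_zero : toReal (0 : N) = 0 := TensorProduct.tmul_zero _ _

lemma isPrimitive_of_apply_eq_one {v : N} {m : Module.Dual ℤ N} (h : m v = 1) :
    IsPrimitive v := by
  rintro k w rfl
  rw [map_smul, smul_eq_mul] at h
  exact IsUnit.of_mul_eq_one _ h

lemma IsPrimitive.ne_zero {v : N} (hv : IsPrimitive v) : v ≠ 0 := by
  rintro rfl
  exact not_isUnit_zero (hv 0 0 (zero_smul _ _).symm)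

variable [Module.Free ℤ N] [Module.Finite ℤ N]

/-- Every nonzero lattice vector is a positive multiple of a vector on which some element of the
dual lattice takes the value one. -/
lemma exists_eq_zsmul_of_ne_zero {v : N} (hv : v ≠ 0) :
    ∃ (d : ℤ) (u : N) (m : Module.Dual ℤ N), 0 < d ∧ v = d • u ∧ m u = 1 := by
  let b := Module.Free.chooseBasis ℤ N
  -- The values `m v` form an ideal of ℤ, whose positive generator `d` is the gcd of the coordinates
  -- of `v`. Dividing by it gives `u`, and a form taking the value `d` at `v` takes the value 1 at
  -- `u`.
  let I : Ideal ℤ := LinearMap.range (Module.Dual.eval ℤ N v)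
  let d : ℤ := |Submodule.IsPrincipal.generator I|
  have hI : ∀ k, k ∈ I ↔ d ∣ k := by
    intro k
    rw [Submodule.IsPrincipal.mem_iff_generator_dvd I, abs_dvd]
  have hcoord : ∀ i, d ∣ b.coord i v := fun i => (hI _).1 ⟨b.coord i, rfl⟩
  choose c hc using hcoord
  have hvu : v = d • ∑ i, c i • b i := by
    conv_lhs => rw [← b.sum_repr v]
    rw [Finset.smul_sum]
    refine Finset.sum_congr rfl fun i _ => ?_
    rw [smul_smul, ← hc i]
    rfl
  have hd : d ≠ 0 := by
    intro h
    rw [h, zero_smul] at hvu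
    exact hv hvu
  obtain ⟨m, hm⟩ := (hI d).2 dvd_rfl
  refine ⟨d, _, m, lt_of_le_of_ne (abs_nonneg _) hd.symm, hvu, ?_⟩
  have h : m v = d := hm
  rw [hvu, map_smul, smul_eq_mul] at h
  exact mul_left_cancel₀ hd (by rw [h, mul_one])

lemma exists_dual_apply_ne_zero {v : N} (hv : v ≠ 0) : ∃ m : Module.Dual ℤ N, m v ≠ 0 := by
  obtain ⟨d, u, m, hd, rfl, hm⟩ := exists_eq_zsmul_of_ne_zero hv
  exact ⟨m, by simp [hm, hd.ne']⟩

lemma eq_of_forall_dual_apply_eq {v w : N} (h : ∀ m : Module.Dual ℤ N, m v = m w) : v = w := by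
  by_contra hne
  obtain ⟨m, hm⟩ := exists_dual_apply_ne_zero (sub_ne_zero.2 hne)
  exact hm (by rw [map_sub, h m, sub_self])

lemma toReal_injective : Function.Injective (toReal : N → RealSpace N) := by
  intro v w h
  refine eq_of_forall_dual_apply_eq fun m => ?_
  have := congrArg (pairing m) h
  rw [pairing_toReal, pairing_toReal] at this
  exact_mod_cast this

lemma IsPrimitive.exists_apply_eq_one {v : N} (hv : IsPrimitive v) :
    ∃ m : Module.Dual ℤ N, m v = 1 := by
  obtain ⟨d, u, m, hd, h, hm⟩ := exists_eq_zsmul_of_ne_zero hv.ne_zero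
  have : d = 1 := by
    rcases Int.isUnit_iff.1 (hv d u h) with h | h
    · exact h
    · omega
  exact ⟨m, by rw [h, this, one_smul, hm]⟩

end Lattice

/-! ### Strong convexity and strictly positive forms -/

section Cones

variable {N : Type u} [AddCommGroup N]

/-- A point of a cone at which a form that is positive on the nonzero generators vanishes is
zero. -/
lemma eq_zero_of_mem_hull {s : Set N} {m : Module.Dual ℤ N}
    (hm : ∀ v ∈ s, toReal v ≠ 0 → 0 < m v) {x : RealSpace N}
    (hx : x ∈ PointedCone.hull ℝ (toReal '' s)) (h : pairing m x = 0) : x = 0 := by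
  -- Nonnegativity is carried through the induction because a sum of nonnegative values vanishes
  -- only if both summands do.
  have key : 0 ≤ pairing m x ∧ (pairing m x = 0 → x = 0) := by
    clear h
    induction hx using Submodule.span_induction with
    | mem x hx =>
      obtain ⟨v, hv, rfl⟩ := hx
      by_cases h0 : toReal v = 0
      · simp [h0]
      · have := hm v hv h0
        rw [pairing_toReal]
        refine ⟨by exact_mod_cast this.le, fun h => ?_⟩
        have : m v = 0 := by exact_mod_cast h
        omega
    | zero => simp
    | add x y _ _ hx hy =>
      rw [map_add]
      refine ⟨add_nonneg hx.1 hy.1, fun h => ?_⟩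
      have h1 := hx.1
      have h2 := hy.1
      rw [hx.2 (by linarith), hy.2 (by linarith), add_zero]
    | smul a x _ hx =>
      have : a • x = (a : ℝ) • x := rfl
      rw [this, map_smul, smul_eq_mul]
      refine ⟨mul_nonneg a.2 hx.1, fun h => ?_⟩
      rcases mul_eq_zero.1 h with h | h
      · rw [h, zero_smul]
      · rw [hx.2 h, smul_zero]
  exact key.2 h

variable [Module.Free ℤ N] [Module.Finite ℤ N]

/-- A strongly convex rational polyhedral cone has a lattice form that is positive on its nonzero
generators. -/
lemma exists_dual_pos (s : Finset N)
    (hs : ∀ x ∈ PointedCone.hull ℝ (toReal '' (s : Set N)),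
      -x ∈ PointedCone.hull ℝ (toReal '' (s : Set N)) → x = 0) :
    ∃ m : Module.Dual ℤ N, ∀ v ∈ s, toReal v ≠ 0 → 0 < m v := by
  classical
  set σ := PointedCone.hull ℝ (toReal '' (s : Set N)) with hσ
  let b := Module.Free.chooseBasis ℤ N
  let B := b.baseChange ℝ
  let t : Set (RealSpace N) := {x | x ∈ toReal '' (s : Set N) ∧ x ≠ 0}
  have htfin : t.Finite := (s.finite_toSet.image _).subset fun x hx => hx.1
  let e := B.equivFun
  -- This is where strong convexity enters: if `p • x + q • y = 0` with `p > 0`, then `-x` lies in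
  -- the cone.
  have hconv : Convex ℝ {x : RealSpace N | x ∈ σ ∧ x ≠ 0} := by
    rintro x ⟨hx, hx0⟩ y ⟨hy, hy0⟩ p q hp hq hpq
    refine ⟨add_mem (σ.smul_mem hp hx) (σ.smul_mem hq hy), fun h => ?_⟩
    rcases hp.eq_or_lt with rfl | hp
    · rw [zero_add] at hpq
      subst hpq
      simp [hy0] at h
    · have hneg : -x = (q / p) • y := by
        have h1 : p⁻¹ • (p • x + q • y) = x + (q / p) • y := by
          rw [smul_add, smul_smul, smul_smul, inv_mul_cancel₀ hp.ne', one_smul]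
          congr 2
          field_simp
        rw [h, smul_zero] at h1
        exact neg_eq_of_add_eq_zero_right h1.symm
      exact hx0 (hs x hx (hneg ▸ σ.smul_mem (div_nonneg hq hp.le) hy))
  have hhull : convexHull ℝ t ⊆ {x : RealSpace N | x ∈ σ ∧ x ≠ 0} :=
    convexHull_min (fun x hx => ⟨Submodule.subset_span hx.1, hx.2⟩) hconv
  have h0 : (0 : Module.Free.ChooseBasisIndex ℤ N → ℝ) ∉ convexHull ℝ (e '' t) := by
    intro h
    have himg : convexHull ℝ (e '' t) = e '' convexHull ℝ t :=
      (e.toLinearMap.image_convexHull t).symm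
    rw [himg] at h
    obtain ⟨x, hx, hx0⟩ := h
    exact (hhull hx).2 (e.map_eq_zero_iff.1 hx0)
  -- The convex hull of the finitely many nonzero generators is compact and misses 0, so a real form
  -- separates them strictly. Working in the coordinates `e` supplies the topology.
  obtain ⟨f, r, hf0, hf⟩ := geometric_hahn_banach_point_closed (convex_convexHull ℝ _)
    ((htfin.image e).isCompact_convexHull (𝕜 := ℝ)).isClosed h0
  rw [map_zero] at hf0
  have hcoord : ∀ v i, e (toReal v) i = (b.repr v i : ℝ) := by
    intro v i
    simp [e, B, toReal]
  -- Coefficient vectors of forms positive on the nonzero generators. Finitely many strict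
  -- inequalities define an open set, so it contains a rational point as soon as it contains the
  -- real one; clearing denominators then gives a lattice form.
  let U : Set (Module.Free.ChooseBasisIndex ℤ N → ℝ) :=
    {c | ∀ v ∈ s.filter (fun v => toReal v ≠ 0), 0 < ∑ i, c i * (b.repr v i : ℝ)}
  have hUo : IsOpen U := by
    have : U = ⋂ v ∈ s.filter (fun v => toReal v ≠ 0),
        {c | 0 < ∑ i, c i * (b.repr v i : ℝ)} := by
      ext c
      simp [U]
    rw [this]
    refine isOpen_biInter_finset fun v _ => isOpen_lt continuous_const ?_
    fun_prop
  have hUn : U.Nonempty := by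
    refine ⟨fun i => f (Pi.single i 1), fun v hv => ?_⟩
    obtain ⟨hv, hv0⟩ := Finset.mem_filter.1 hv
    have h1 := hf _ (subset_convexHull ℝ _ ⟨_, ⟨⟨v, hv, rfl⟩, hv0⟩, rfl⟩)
    have h2 : f (e (toReal v)) = ∑ i, f (Pi.single i 1) * (b.repr v i : ℝ) := by
      conv_lhs => rw [pi_eq_sum_univ' (e (toReal v))]
      rw [map_sum]
      refine Finset.sum_congr rfl fun i _ => ?_
      rw [map_smul, hcoord, smul_eq_mul, mul_comm]
    rw [← h2]
    exact hf0.trans h1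
  have hdense : DenseRange fun (q : Module.Free.ChooseBasisIndex ℤ N → ℚ) i => (q i : ℝ) :=
    DenseRange.piMap fun _ => Rat.denseRange_cast
  obtain ⟨q, hq⟩ := hdense.exists_mem_open hUo hUn
  let D : ℤ := ∏ i, ((q i).den : ℤ)
  have hD : 0 < D := Finset.prod_pos fun i _ => by exact_mod_cast (q i).pos
  have hDq : ∀ i, ∃ k : ℤ, (k : ℝ) = D * q i := by
    intro i
    obtain ⟨k, hk⟩ := Finset.dvd_prod_of_mem (fun i => ((q i).den : ℤ)) (Finset.mem_univ i)
    refine ⟨k * (q i).num, ?_⟩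
    have h1 : (q i : ℝ) * (q i).den = (q i).num := by exact_mod_cast (q i).mul_den_eq_num
    have h2 : (D : ℝ) = (q i).den * k := by
      have h3 : D = (q i).den * k := hk
      rw [h3]
      push_cast
      rfl
    push_cast
    rw [h2, ← h1]
    ring
  choose k hk using hDq
  refine ⟨∑ i, k i • b.coord i, fun v hv hv0 => ?_⟩
  have h1 := hq v (Finset.mem_filter.2 ⟨hv, hv0⟩)
  have h2 : (((∑ i, k i • b.coord i) v : ℤ) : ℝ) = D * ∑ i, (q i : ℝ) * (b.repr v i : ℝ) := by
    rw [Finset.mul_sum]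
    simp only [LinearMap.sum_apply, LinearMap.smul_apply, Module.Basis.coord_apply, smul_eq_mul,
      Int.cast_sum, Int.cast_mul, hk, mul_assoc]
  have h3 : (0 : ℝ) < ((∑ i, k i • b.coord i) v : ℤ) := by
    rw [h2]
    exact mul_pos (by exact_mod_cast hD) h1
  exact_mod_cast h3

end Cones

/-! ### Faces of cones and generators of rays -/

section Cones

variable {N : Type u} [AddCommGroup N]

/-- The face `σ ∩ m^⊥` of a cone. -/
noncomputable def faceOf (σ : PointedCone ℝ (RealSpace N)) (m : Module.Dual ℤ N) :
    PointedCone ℝ (RealSpace N) where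
  carrier := {x | x ∈ σ ∧ pairing m x = 0}
  zero_mem' := ⟨zero_mem _, map_zero _⟩
  add_mem' := fun ha hb => ⟨add_mem ha.1 hb.1, by rw [map_add, ha.2, hb.2, add_zero]⟩
  smul_mem' := fun c x hx => ⟨Submodule.smul_mem _ c hx.1, by
    have : c • x = (c : ℝ) • x := rfl
    rw [this, map_smul, hx.2, smul_zero]⟩

lemma faceOf_le (σ : PointedCone ℝ (RealSpace N)) (m : Module.Dual ℤ N) : faceOf σ m ≤ σ :=
  fun _ hx => hx.1

lemma isFace_faceOf {σ : PointedCone ℝ (RealSpace N)} {m : Module.Dual ℤ N}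
    (hm : m ∈ dualMonoid σ) : IsFace (faceOf σ m) σ := ⟨m, hm, fun _ => Iff.rfl⟩

lemma mem_hull_of_mem {s : Set N} {v : N} (hv : v ∈ s) :
    toReal v ∈ PointedCone.hull ℝ (toReal '' s) := Submodule.subset_span ⟨v, hv, rfl⟩

lemma dual_nonneg {σ : PointedCone ℝ (RealSpace N)} {m : Module.Dual ℤ N} (hm : m ∈ dualMonoid σ)
    {v : N} (hv : toReal v ∈ σ) : 0 ≤ m v := by
  have := hm _ hv
  rw [pairing_toReal] at this
  exact_mod_cast this

lemma dual_apply_eq_zero {v : N} (hv : toReal v = 0) (m : Module.Dual ℤ N) : m v = 0 := by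
  have := congrArg (pairing m) hv
  rw [pairing_toReal, map_zero] at this
  exact_mod_cast this

lemma mem_dualMonoid_of_pos {s : Set N} {m : Module.Dual ℤ N}
    (hm : ∀ v ∈ s, toReal v ≠ 0 → 0 < m v) :
    m ∈ dualMonoid (PointedCone.hull ℝ (toReal '' s)) := by
  rw [mem_dualMonoid_hull]
  intro v hv
  by_cases h : toReal v = 0
  · exact (dual_apply_eq_zero h m).ge
  · exact (hm v hv h).le

/-- Given a form `m` that is positive on the nonzero generators, any form `m'` attains its maximum
relative to `m` at a generator. -/
lemma exists_generator_max {s : Finset N} {m : Module.Dual ℤ N}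
    (hm : ∀ v ∈ s, toReal v ≠ 0 → 0 < m v) (hs : ∃ v ∈ s, toReal v ≠ 0)
    (m' : Module.Dual ℤ N) : ∃ w ∈ s, toReal w ≠ 0 ∧
      ∀ v ∈ s, m' v * m w ≤ m' w * m v := by
  classical
  have hne : (s.filter fun v => toReal v ≠ 0).Nonempty := by
    obtain ⟨v, hv, hv0⟩ := hs
    exact ⟨v, Finset.mem_filter.2 ⟨hv, hv0⟩⟩
  obtain ⟨w, hw, hmax⟩ := Finset.exists_max_image _ (fun v => (m' v : ℚ) / m v) hne
  obtain ⟨hw, hw0⟩ := Finset.mem_filter.1 hw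
  refine ⟨w, hw, hw0, fun v hv => ?_⟩
  by_cases hv0 : toReal v = 0
  · rw [dual_apply_eq_zero hv0, dual_apply_eq_zero hv0, zero_mul, mul_zero]
  · have h1 := hmax v (Finset.mem_filter.2 ⟨hv, hv0⟩)
    have h2 : (0 : ℚ) < m v := by exact_mod_cast hm v hv hv0
    have h3 : (0 : ℚ) < m w := by exact_mod_cast hm w hw hw0
    rw [div_le_div_iff₀ h2 h3] at h1
    exact_mod_cast h1

/-- This form also vanishes at `w`, so it cuts out a face through the generator `w`. Maximising a
ratio of forms thus produces faces without any dimension theory. -/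
lemma mem_dualMonoid_of_max {s : Finset N} {m m' : Module.Dual ℤ N} {w : N}
    (hmax : ∀ v ∈ s, m' v * m w ≤ m' w * m v) :
    m' w • m - m w • m' ∈ dualMonoid (PointedCone.hull ℝ (toReal '' (s : Set N))) := by
  rw [mem_dualMonoid_hull]
  intro v hv
  have := hmax v hv
  simp only [LinearMap.sub_apply, LinearMap.smul_apply, smul_eq_mul]
  linarith

lemma exists_generator_ne_zero {s : Finset N}
    (h : PointedCone.hull ℝ (toReal '' (s : Set N)) ≠ ⊥) : ∃ v ∈ s, toReal v ≠ 0 := by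
  by_contra! hs
  refine h (Submodule.span_eq_bot.2 ?_)
  rintro _ ⟨v, hv, rfl⟩
  exact hs v hv

lemma span_hull (t : Set (RealSpace N)) :
    Submodule.span ℝ (PointedCone.hull ℝ t : Set (RealSpace N)) = Submodule.span ℝ t :=
  le_antisymm (Submodule.span_le.2 fun x hx => by
    induction hx using Submodule.span_induction with
    | mem x hx => exact Submodule.subset_span hx
    | zero => exact zero_mem _
    | add x y _ _ hx hy => exact add_mem hx hy
    | smul a x _ hx => exact Submodule.smul_mem _ (a : ℝ) hx)
    (Submodule.span_mono Submodule.subset_span)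

variable [Module.Free ℤ N] [Module.Finite ℤ N]

/-- A strongly convex rational polyhedral cone of dimension at least two has a nonzero proper
face. -/
lemma exists_face_of_finrank_ne_one {σ : PointedCone ℝ (RealSpace N)} (hσ : IsRationalPolyhedral σ)
    (hsc : ∀ x ∈ σ, -x ∈ σ → x = 0) (hne : σ ≠ ⊥)
    (hdim : Module.finrank ℝ (Submodule.span ℝ (σ : Set (RealSpace N))) ≠ 1) :
    ∃ m ∈ dualMonoid σ, ∃ v w : N, toReal v ∈ σ ∧ toReal w ∈ σ ∧ toReal v ≠ 0 ∧ m v = 0 ∧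
      0 < m w := by
  obtain ⟨s, rfl⟩ := hσ
  obtain ⟨m₀, hm₀⟩ := exists_dual_pos s hsc
  have hs := exists_generator_ne_zero hne
  obtain ⟨a, ha, ha0⟩ := hs
  have hma := hm₀ a ha ha0
  -- A generator `c` not proportional to `a`; if there were none, the cone would span a line.
  obtain ⟨c, hc, hca⟩ : ∃ c ∈ s, m₀ a • c - m₀ c • a ≠ 0 := by
    by_contra! h
    refine hdim ?_
    have : Submodule.span ℝ (toReal '' (s : Set N)) = Submodule.span ℝ {toReal a} := by
      refine le_antisymm (Submodule.span_le.2 ?_) (Submodule.span_mono ?_)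
      · rintro _ ⟨v, hv, rfl⟩
        have h1 := congrArg toReal (sub_eq_zero.1 (h v hv))
        rw [toReal_zsmul, toReal_zsmul] at h1
        have h2 : (m₀ a : ℝ) ≠ 0 := by exact_mod_cast hma.ne'
        refine Submodule.mem_span_singleton.2 ⟨(m₀ a : ℝ)⁻¹ * m₀ v, ?_⟩
        rw [mul_smul, ← h1, smul_smul, inv_mul_cancel₀ h2, one_smul]
      · rintro _ rfl
        exact ⟨a, ha, rfl⟩
    rw [span_hull, this]
    exact finrank_span_singleton ha0
  obtain ⟨m', hm'⟩ := exists_dual_apply_ne_zero hca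
  obtain ⟨w, hw, hw0, hmax⟩ := exists_generator_max hm₀ ⟨a, ha, ha0⟩ m'
  have hmem := mem_dualMonoid_of_max hmax
  -- Otherwise `m'` is proportional to `m₀` on all generators, which contradicts `m'` being nonzero
  -- at `m₀ a • c - m₀ c • a`.
  have hpos : ∃ v ∈ s, 0 < (m' w • m₀ - m₀ w • m') v := by
    by_contra! hle
    have hz : ∀ v ∈ s, m' w * m₀ v = m₀ w * m' v := by
      intro v hv
      have h1 := le_antisymm (hle v hv) (dual_nonneg hmem (mem_hull_of_mem hv))
      simp only [LinearMap.sub_apply, LinearMap.smul_apply, smul_eq_mul] at h1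
      linarith
    have h1 := hz a ha
    have h2 := hz c hc
    refine hm' ?_
    rw [map_sub, map_smul, map_smul, smul_eq_mul, smul_eq_mul]
    have h3 : m₀ w * (m₀ a * m' c - m₀ c * m' a) = 0 := by
      linear_combination m₀ c * h1 - m₀ a * h2
    exact (mul_eq_zero.1 h3).resolve_left (hm₀ w hw hw0).ne'
  obtain ⟨v, hv, hpos⟩ := hpos
  refine ⟨_, hmem, w, v, mem_hull_of_mem hw, mem_hull_of_mem hv, hw0, ?_, hpos⟩
  simp only [LinearMap.sub_apply, LinearMap.smul_apply, smul_eq_mul]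
  ring

/-- Divide a nonzero generator by its content. The other generators are real multiples of it, and
nonnegative ones because `m₀` is positive on all the nonzero generators. -/
lemma exists_isPrimitiveGenerator {σ : PointedCone ℝ (RealSpace N)} (hσ : IsRationalPolyhedral σ)
    (hsc : ∀ x ∈ σ, -x ∈ σ → x = 0)
    (hdim : Module.finrank ℝ (Submodule.span ℝ (σ : Set (RealSpace N))) = 1) :
    ∃ v, IsPrimitiveGenerator v σ := by
  obtain ⟨s, rfl⟩ := hσ
  obtain ⟨m₀, hm₀⟩ := exists_dual_pos s hsc
  have hne : PointedCone.hull ℝ (toReal '' (s : Set N)) ≠ ⊥ := by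
    intro h
    have h0 : Submodule.span ℝ ((⊥ : PointedCone ℝ (RealSpace N)) : Set (RealSpace N)) = ⊥ :=
      Submodule.span_eq_bot.2 fun x hx => hx
    rw [h, h0, finrank_bot] at hdim
    exact absurd hdim zero_ne_one
  obtain ⟨a, ha, ha0⟩ := exists_generator_ne_zero hne
  have hma := hm₀ a ha ha0
  obtain ⟨d, u, m, hd, rfl, hm⟩ := exists_eq_zsmul_of_ne_zero
    (v := a) (fun h => ha0 (by rw [h, toReal_zero]))
  have hd' : (0 : ℝ) < d := by exact_mod_cast hd
  refine ⟨u, isPrimitive_of_apply_eq_one hm, le_antisymm ?_ ?_⟩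
  · refine Submodule.span_le.2 ?_
    rintro _ ⟨v, hv, rfl⟩
    have hmem : ∀ w ∈ s, toReal w ∈ Submodule.span ℝ
        (PointedCone.hull ℝ (toReal '' (s : Set N)) : Set (RealSpace N)) :=
      fun w hw => Submodule.subset_span (mem_hull_of_mem hw)
    obtain ⟨c, hc⟩ := (finrank_eq_one_iff_of_nonzero' (⟨_, hmem _ ha⟩ : Submodule.span ℝ
        (PointedCone.hull ℝ (toReal '' (s : Set N)) : Set (RealSpace N)))
      (by simpa using ha0)).1 hdim ⟨_, hmem v hv⟩
    replace hc : c • toReal (d • u) = toReal v := congrArg Subtype.val hc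
    have hc0 : 0 ≤ c := by
      by_cases hv0 : toReal v = 0
      · rw [hv0] at hc
        exact ((smul_eq_zero.1 hc).resolve_right ha0).ge
      · have h1 := congrArg (pairing m₀) hc
        rw [map_smul, pairing_toReal, pairing_toReal, smul_eq_mul] at h1
        have h2 : (0 : ℝ) < m₀ (d • u) := by exact_mod_cast hma
        have h3 : (0 : ℝ) < m₀ v := by exact_mod_cast hm₀ v hv hv0
        rw [← h1] at h3
        exact (pos_of_mul_pos_left h3 h2.le).le
    rw [← hc, toReal_zsmul, smul_smul]
    exact PointedCone.smul_mem _ (mul_nonneg hc0 hd'.le) (Submodule.subset_span rfl)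
  · refine Submodule.span_le.2 ?_
    rintro _ rfl
    have h1 : toReal u = (d : ℝ)⁻¹ • toReal (d • u) := by
      rw [toReal_zsmul, smul_smul, inv_mul_cancel₀ hd'.ne', one_smul]
    rw [h1]
    exact PointedCone.smul_mem _ (inv_nonneg.2 hd'.le) (mem_hull_of_mem ha)

/-- The primitive generator of a ray is unique. -/
lemma IsPrimitiveGenerator.eq {ρ : PointedCone ℝ (RealSpace N)} {v w : N}
    (hv : IsPrimitiveGenerator v ρ) (hw : IsPrimitiveGenerator w ρ) : v = w := by
  obtain ⟨hv, rfl⟩ := hv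
  obtain ⟨hw, h⟩ := hw
  obtain ⟨m, hm⟩ := hv.exists_apply_eq_one
  obtain ⟨n, hn⟩ := hw.exists_apply_eq_one
  obtain ⟨a, ha⟩ := Submodule.mem_span_singleton.1
    (h ▸ Submodule.subset_span rfl : toReal v ∈ PointedCone.hull ℝ {toReal w})
  obtain ⟨b, hb⟩ := Submodule.mem_span_singleton.1
    (h ▸ Submodule.subset_span rfl : toReal w ∈ PointedCone.hull ℝ {toReal v})
  have ha' : (a : ℝ) • toReal w = toReal v := ha
  have hb' : (b : ℝ) • toReal v = toReal w := hb
  have h1 := congrArg (pairing m) ha'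
  have h2 := congrArg (pairing n) hb'
  have h3 := congrArg (pairing n) ha'
  rw [map_smul, pairing_toReal, pairing_toReal, smul_eq_mul] at h1 h2 h3
  rw [hm] at h1
  rw [hn] at h2 h3
  rw [Int.cast_one, mul_one] at h3
  rw [h3] at h1
  -- The coefficient taking `w` to `v` is the integer `n v`. It is invertible in ℤ and nonnegative,
  -- hence 1.
  have h4 : n v * m w = 1 := by exact_mod_cast h1
  have h5 : 0 ≤ n v := by
    have : (0 : ℝ) ≤ n v := h3 ▸ a.2
    exact_mod_cast this
  have h6 : n v = 1 := by
    rcases Int.eq_one_or_neg_one_of_mul_eq_one h4 with h | h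
    · exact h
    · omega
  rw [h6] at h3
  rw [h3, Int.cast_one, one_smul] at ha'
  exact toReal_injective ha'.symm

end Cones

/-! ### The rays of a fan determine its linear span -/

namespace Fan

variable {N : Type u} [AddCommGroup N] (F : Fan N)

lemma faceOf_mem {σ : PointedCone ℝ (RealSpace N)} (hσ : σ ∈ F.cones) {m : Module.Dual ℤ N}
    (hm : m ∈ dualMonoid σ) : faceOf σ m ∈ F.cones :=
  F.face_mem σ hσ _ (isFace_faceOf hm)

variable [Module.Free ℤ N] [Module.Finite ℤ N]

/-- A form strictly positive on the nonzero generators of a cone cuts out the zero face. -/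
lemma bot_mem : ⊥ ∈ F.cones := by
  obtain ⟨σ, hσ⟩ := F.nonempty
  obtain ⟨s, hs⟩ := F.rational σ hσ
  obtain ⟨m, hm⟩ := exists_dual_pos s (hs ▸ F.stronglyConvex σ hσ)
  have hmem : m ∈ dualMonoid σ := hs ▸ mem_dualMonoid_of_pos hm
  have : faceOf σ m = ⊥ := by
    rw [eq_bot_iff]
    rintro x ⟨hx, hx0⟩
    exact eq_zero_of_mem_hull hm (hs ▸ hx) hx0
  exact this ▸ F.faceOf_mem hσ hmem

/-- A lattice form vanishing on the primitive generators of all rays of a fan vanishes on the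
support of the fan. -/
lemma pairing_eq_zero_of_forall_ray {m : Module.Dual ℤ N}
    (hm : ∀ ρ ∈ F.rays, ∀ v, IsPrimitiveGenerator v ρ → m v = 0) (σ : F.cones) :
    ∀ x ∈ σ.1, pairing m x = 0 := by
  have := F.finite.to_subtype
  -- Induction on cones under inclusion. In dimension at least two, `m` already vanishes on the
  -- lattice points of every proper face, and the extremal faces of `m` and `-m` bound it from both
  -- sides.
  induction σ using (Finite.to_wellFoundedLT (α := F.cones)).wf.induction with
  | _ σ ih =>
  obtain ⟨σ, hσ⟩ := σ
  by_cases hray : Module.finrank ℝ (Submodule.span ℝ (σ : Set (RealSpace N))) = 1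
  · obtain ⟨v, hv⟩ := exists_isPrimitiveGenerator (F.rational σ hσ) (F.stronglyConvex σ hσ) hray
    have hmv := hm σ ⟨hσ, hray⟩ v hv
    intro x hx
    replace hx : x ∈ σ := hx
    rw [hv.2] at hx
    obtain ⟨a, rfl⟩ := Submodule.mem_span_singleton.1 hx
    change pairing m ((a : ℝ) • toReal v) = 0
    rw [map_smul, pairing_toReal, hmv, Int.cast_zero, smul_zero]
  by_cases hbot : σ = ⊥
  · subst hbot
    rintro x rfl
    exact map_zero _
  obtain ⟨m₁, hm₁, a, b, haσ, hbσ, ha0, hm₁a, hm₁b⟩ := exists_face_of_finrank_ne_one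
    (F.rational σ hσ) (F.stronglyConvex σ hσ) hbot hray
  have proper : ∀ n ∈ dualMonoid σ, (∃ x, toReal x ∈ σ ∧ n x ≠ 0) → ∀ y, toReal y ∈ σ → n y = 0 →
      m y = 0 := by
    rintro n hn ⟨x, hx, hnx⟩ y hy hny
    have hlt : (⟨_, F.faceOf_mem hσ hn⟩ : F.cones) < ⟨σ, hσ⟩ := by
      refine lt_of_le_not_ge (faceOf_le σ n) fun h => hnx ?_
      have h1 := (h hx : toReal x ∈ faceOf σ n).2
      rw [pairing_toReal] at h1
      exact_mod_cast h1
    have h1 := ih _ hlt (toReal y) ⟨hy, by rw [pairing_toReal, hny, Int.cast_zero]⟩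
    rw [pairing_toReal] at h1
    exact_mod_cast h1
  have hma : m a = 0 := proper m₁ hm₁ ⟨b, hbσ, hm₁b.ne'⟩ a haσ hm₁a
  obtain ⟨s, hs⟩ := F.rational σ hσ
  obtain ⟨m₀, hm₀⟩ := exists_dual_pos s (hs ▸ F.stronglyConvex σ hσ)
  have hm₀a : m₀ a ≠ 0 := by
    intro h
    refine ha0 (eq_zero_of_mem_hull hm₀ (hs ▸ haσ) ?_)
    rw [pairing_toReal, h, Int.cast_zero]
  -- Applied to `n = m` and `n = -m`. At the maximum `w` of `n / m₀`, the supporting form either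
  -- cuts a proper face, where the induction gives `n w = 0`, or vanishes at every lattice point of
  -- the cone; then evaluation at `a`, where `n` but not `m₀` vanishes, again gives `n w = 0`.
  have key : ∀ n : Module.Dual ℤ N, n a = 0 → (∀ y, m y = 0 → n y = 0) → ∀ v ∈ s, n v ≤ 0 := by
    intro n hna hmn v hv
    obtain ⟨w, hw, hw0, hmax⟩ := exists_generator_max hm₀
      (exists_generator_ne_zero (hs ▸ hbot)) n
    have hmem := mem_dualMonoid_of_max hmax
    rw [← hs] at hmem
    have hnw : n w = 0 := by
      by_cases h : ∃ x, toReal x ∈ σ ∧ (n w • m₀ - m₀ w • n) x ≠ 0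
      · refine hmn w (proper _ hmem h w (hs ▸ mem_hull_of_mem hw) ?_)
        simp only [LinearMap.sub_apply, LinearMap.smul_apply, smul_eq_mul]
        ring
      · push Not at h
        have h1 := h a haσ
        simp only [LinearMap.sub_apply, LinearMap.smul_apply, smul_eq_mul, hna, mul_zero,
          sub_zero] at h1
        exact (mul_eq_zero.1 h1).resolve_right hm₀a
    have h1 := hmax v hv
    rw [hnw, zero_mul] at h1
    exact nonpos_of_mul_nonpos_left h1 (hm₀ w hw hw0)
  have h1 := key m hma (fun _ h => h)
  have h2 := key (-m) (by simp [hma]) (fun y h => by simp [h])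
  intro x hx
  replace hx : x ∈ σ := hx
  rw [hs] at hx
  induction hx using Submodule.span_induction with
  | mem x hx =>
    obtain ⟨v, hv, rfl⟩ := hx
    have h3 := h1 v hv
    have h4 := h2 v hv
    rw [LinearMap.neg_apply] at h4
    rw [pairing_toReal, show m v = 0 by omega, Int.cast_zero]
  | zero => exact map_zero _
  | add x y _ _ hx hy => rw [map_add, hx, hy, add_zero]
  | smul a x _ hx =>
    change pairing m ((a : ℝ) • x) = 0
    rw [map_smul, hx, smul_zero]

/-- For a non-degenerate fan, the primitive generators of the rays span `N_ℝ`. -/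
lemma eq_zero_of_forall_ray (hF : F.IsNondegenerate) {m : Module.Dual ℤ N}
    (hm : ∀ ρ ∈ F.rays, ∀ v, IsPrimitiveGenerator v ρ → m v = 0) : m = 0 := by
  have h : pairing m = 0 := by
    refine LinearMap.ext_on hF ?_
    intro x hx
    simp only [support, Set.mem_iUnion] at hx
    obtain ⟨σ, hσ, hx⟩ := hx
    exact F.pairing_eq_zero_of_forall_ray hm ⟨σ, hσ⟩ x hx
  ext v
  have h1 := congrArg (fun f => f (toReal v)) h
  simp only [pairing_toReal, LinearMap.zero_apply] at h1
  exact_mod_cast h1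

end Fan

/-! ### Torsion of the cokernel of a dual map -/

section Torsion

/-- If `ℤ^V → C` is a surjection whose kernel is the image of the dual lattice under the map dual to
`ℤ^V → N`, and the image of the latter has finite index in `N`, then the torsion of `C` is
isomorphic to the cokernel of `ℤ^V → N`. -/
theorem nonempty_torsion_addEquiv {N : Type*} [AddCommGroup N] [Module.Free ℤ N]
    [Module.Finite ℤ N] {C : Type*} [AddCommGroup C] {V : Type*} (u : V → N)
    (D : (V → ℤ) →+ C) (hD : Function.Surjective D)
    (hker : ∀ c, D c = 0 ↔ ∃ m : Module.Dual ℤ N, ∀ v, c v = m (u v))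
    (hu : ∀ m : Module.Dual ℤ N, (∀ v, m (u v) = 0) → m = 0) :
    Nonempty (AddCommGroup.torsion C ≃+ N ⧸ Submodule.span ℤ (Set.range u)) := by
  set N₁ := Submodule.span ℤ (Set.range u) with hN₁
  have huv : ∀ v, u v ∈ N₁ := fun v => Submodule.subset_span ⟨v, rfl⟩
  -- Adapted bases: `bN j = a j • bM (f j)`.
  obtain ⟨n, bM, bN, f, a, snf⟩ := N₁.smithNormalForm (Module.Free.chooseBasis ℤ N)
  have hcoord : ∀ i j, bM.coord (f j) (bN i : N) = if i = j then a i else 0 := by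
    intro i j
    rw [snf, map_smul, Module.Basis.coord_apply, Module.Basis.repr_self, Finsupp.single_apply]
    simp [f.injective.eq_iff]
  -- A coordinate form missed by `f` would vanish on `N₁` and so be zero by `hu`. Thus `N₁` has full
  -- rank.
  have hsurj : Function.Surjective f := by
    intro i
    by_contra! hi
    have h0 : bM.coord i = 0 := by
      refine hu _ fun v => ?_
      have h1 : (⟨u v, huv v⟩ : N₁) = ∑ j, bN.repr ⟨u v, huv v⟩ j • bN j := (bN.sum_repr _).symm
      have h2 := congrArg (fun x : N₁ => bM.coord i (x : N)) h1
      simp only [Submodule.coe_sum, Submodule.coe_smul, snf, map_sum, map_smul] at h2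
      rw [h2]
      refine Finset.sum_eq_zero fun j _ => ?_
      rw [Module.Basis.coord_apply, Module.Basis.repr_self, Finsupp.single_eq_of_ne (hi j).symm]
      simp
    have h1 := congrArg (fun m => m (bM i)) h0
    simp at h1
  have ha : ∀ i, a i ≠ 0 := by
    intro i h
    have h1 := snf i
    rw [h, zero_smul] at h1
    exact bN.ne_zero i (Subtype.ext h1)
  -- the form on `N₁` with the same coordinates as a given vector of `N`
  let ψ : N →ₗ[ℤ] N₁ →ₗ[ℤ] ℤ := LinearMap.flip
    (∑ j, (bN.coord j).smulRight (bM.coord (f j)))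
  have hψ : ∀ x y, ψ x y = ∑ j, bN.repr y j * bM.coord (f j) x := by
    intro x y
    simp [ψ, LinearMap.sum_apply]
  have hψb : ∀ x j, ψ x (bN j) = bM.coord (f j) x := by
    intro x j
    rw [hψ, Finset.sum_eq_single j]
    · simp
    · intro i _ hi
      rw [Module.Basis.repr_self, Finsupp.single_eq_of_ne hi, zero_mul]
    · simp
  have hext : ∀ g g' : N₁ →ₗ[ℤ] ℤ, (∀ v, g ⟨u v, huv v⟩ = g' ⟨u v, huv v⟩) → g = g' := by
    intro g g' h
    refine LinearMap.ext fun ⟨x, hx⟩ => ?_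
    induction hx using Submodule.span_induction with
    | mem x hx =>
      obtain ⟨v, rfl⟩ := hx
      exact h v
    | zero => exact (map_zero g).trans (map_zero g').symm
    | add x y hx hy h1 h2 =>
      have h3 : (⟨x + y, add_mem hx hy⟩ : N₁) = ⟨x, hx⟩ + ⟨y, hy⟩ := rfl
      rw [h3, map_add, map_add, h1, h2]
    | smul c x hx h1 =>
      have h3 : (⟨c • x, N₁.smul_mem c hx⟩ : N₁) = c • ⟨x, hx⟩ := rfl
      rw [h3, map_smul, map_smul, h1]
  let Θ : N →+ C := D.comp
    { toFun := fun x v => ψ x ⟨u v, huv v⟩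
      map_zero' := by ext; simp
      map_add' := by intros; ext; simp }
  have hΘ : ∀ x, Θ x = D fun v => ψ x ⟨u v, huv v⟩ := fun _ => rfl
  -- `Θ x = 0` means that the form `ψ x` on `N₁` extends to `N`. Since `bN j = a j • bM (f j)`, this
  -- happens exactly when each `a j` divides the corresponding coordinate of `x`, which is
  -- membership in `N₁`.
  have hΘker : ∀ x, Θ x = 0 ↔ x ∈ N₁ := by
    intro x
    rw [hΘ, hker]
    constructor
    · rintro ⟨m, hm⟩
      have h1 : ψ x = m ∘ₗ N₁.subtype := hext _ _ hm
      have h2 : x = ∑ j, m (bM (f j)) • (bN j : N) := by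
        refine bM.ext_elem fun i => ?_
        obtain ⟨k, rfl⟩ := hsurj i
        have h3 : bM.coord (f k) x = a k * m (bM (f k)) := by
          rw [← hψb, h1, LinearMap.comp_apply, Submodule.subtype_apply, snf, map_smul, smul_eq_mul]
        rw [← Module.Basis.coord_apply, ← Module.Basis.coord_apply, h3, map_sum,
          Finset.sum_eq_single k]
        · rw [map_smul, hcoord, if_pos rfl, smul_eq_mul, mul_comm]
        · intro j _ hj
          rw [map_smul, hcoord, if_neg hj, smul_zero]
        · simp
      rw [h2]
      exact Submodule.sum_mem _ fun j _ => N₁.smul_mem _ (bN j).2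
    · intro hx
      let e : Fin n ≃ _ := Equiv.ofBijective f ⟨f.injective, hsurj⟩
      let m : Module.Dual ℤ N := bM.constr ℤ fun i => bN.repr ⟨x, hx⟩ (e.symm i)
      have hmb : ∀ j, m (bM (f j)) = bN.repr ⟨x, hx⟩ j := by
        intro j
        have : e.symm (f j) = j := e.symm_apply_apply j
        simp [m, this]
      refine ⟨m, fun v => ?_⟩
      have h1 : ψ x = m ∘ₗ N₁.subtype := by
        refine bN.ext fun j => ?_
        rw [hψb, LinearMap.comp_apply, Submodule.subtype_apply, snf, map_smul, hmb]
        have h2 : x = ((∑ i, bN.repr ⟨x, hx⟩ i • bN i : N₁) : N) := by rw [bN.sum_repr]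
        conv_lhs => rw [h2]
        rw [Submodule.coe_sum, map_sum, Finset.sum_eq_single j]
        · rw [Submodule.coe_smul, map_smul, hcoord, if_pos rfl, smul_eq_mul, smul_eq_mul, mul_comm]
        · intro i _ hi
          rw [Submodule.coe_smul, map_smul, hcoord, if_neg hi, smul_zero]
        · simp
      rw [h1]
      rfl
  have hprod : (∏ j, a j) ≠ 0 := Finset.prod_ne_zero_iff.2 fun j _ => ha j
  have hindex : ∀ x : N, (∏ j, a j) • x ∈ N₁ := by
    intro x
    rw [← bM.sum_repr x, Finset.smul_sum]
    refine Submodule.sum_mem _ fun i _ => ?_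
    obtain ⟨j, rfl⟩ := hsurj i
    obtain ⟨c, hc⟩ := Finset.dvd_prod_of_mem a (Finset.mem_univ j)
    have : (∏ j, a j) • bM.repr x (f j) • bM (f j) = (c * bM.repr x (f j)) • (bN j : N) := by
      rw [hc, snf, smul_smul, smul_smul]
      congr 1
      ring
    rw [this]
    exact N₁.smul_mem _ (bN j).2
  have hΘmem : ∀ x, Θ x ∈ AddCommGroup.torsion C := by
    intro x
    have h1 : (∏ j, a j) • Θ x = 0 := by
      rw [← map_zsmul]
      exact (hΘker _).2 (hindex x)
    exact isOfFinAddOrder_iff_zsmul_eq_zero.2 ⟨_, hprod, h1⟩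
  let Θ' : N →+ AddCommGroup.torsion C := Θ.codRestrict _ hΘmem
  have hΘ'surj : Function.Surjective Θ' := by
    rintro ⟨x, hx⟩
    obtain ⟨k, hk, hkx⟩ := isOfFinAddOrder_iff_zsmul_eq_zero.1 hx
    obtain ⟨c, rfl⟩ := hD x
    rw [← map_zsmul, hker] at hkx
    obtain ⟨m, hm⟩ := hkx
    -- If `k • c` is given by `m`, then `m / k` is an integral form on `N₁`. Its values `g j` on
    -- `bN` are the coordinates of the preimage.
    have hdvd : ∀ y ∈ N₁, k ∣ m y := by
      intro y hy
      induction hy using Submodule.span_induction with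
      | mem y hy =>
        obtain ⟨v, rfl⟩ := hy
        exact ⟨c v, (hm v).symm⟩
      | zero => simp
      | add y z _ _ hy hz => rw [map_add]; exact dvd_add hy hz
      | smul b y _ hy => rw [map_smul]; exact Dvd.dvd.mul_left hy b
    choose g hg using fun j => hdvd (bN j) (bN j).2
    refine ⟨∑ j, g j • bM (f j), Subtype.ext ?_⟩
    change Θ _ = D c
    rw [hΘ]
    congr 1
    funext v
    have h1 : k • ψ (∑ j, g j • bM (f j)) = m ∘ₗ N₁.subtype := by
      refine bN.ext fun j => ?_
      rw [LinearMap.smul_apply, hψb, map_sum, Finset.sum_eq_single j]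
      · simp [hg]
      · intro i _ hi
        simp [hi]
      · simp
    have h2 := congrArg (fun g => g ⟨u v, huv v⟩) h1
    have h3 := hm v
    simp only [LinearMap.smul_apply, LinearMap.comp_apply, Submodule.subtype_apply, smul_eq_mul,
      Pi.smul_apply] at h2 h3
    exact mul_left_cancel₀ hk (h2.trans h3.symm)
  have hker' : Θ'.ker = N₁.toAddSubgroup := by
    ext x
    rw [AddMonoidHom.mem_ker, Submodule.mem_toAddSubgroup, ← hΘker, Subtype.ext_iff]
    rfl
  exact ⟨((QuotientAddGroup.quotientAddEquivOfEq hker').symm.trans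
    (QuotientAddGroup.quotientKerEquivOfSurjective Θ' hΘ'surj)).symm⟩

end Torsion

/-! ### Units of monoid algebras -/

section Units

open scoped Finset

/-- The units of a monoid algebra with two unique sums are monomials. -/
lemma exists_eq_single_of_isUnit {k A : Type*} [Field k] [AddMonoid A] [TwoUniqueSums A]
    {f : AddMonoidAlgebra k A} (hf : IsUnit f) : ∃ a c, c ≠ 0 ∧ f = .single a c := by
  obtain ⟨g, hfg⟩ := hf.exists_right_inv
  have hsupp : ∀ a, (f * g).coeff a ≠ 0 → a = 0 := by
    intro a ha
    by_contra h
    rw [hfg, AddMonoidAlgebra.one_def] at ha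
    simp [Ne.symm h] at ha
  have hf0 : f.coeff.support.Nonempty := by
    rw [Finsupp.support_nonempty_iff]
    intro h
    have : f = 0 := by ext; simp [h]
    exact hf.ne_zero this
  have hg0 : g.coeff.support.Nonempty := by
    rw [Finsupp.support_nonempty_iff]
    intro h
    have : g = 0 := by ext; simp [h]
    rw [this, mul_zero] at hfg
    exact zero_ne_one hfg
  -- With more than one pair of exponents there are two distinct pairs with unique sums. Neither
  -- coefficient can cancel, so both sums equal 0 as `f * g = 1`, against uniqueness.
  have hcard : #f.coeff.support * #g.coeff.support ≤ 1 := by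
    by_contra! h
    obtain ⟨p, hp, q, hq, hne, hup, huq⟩ := TwoUniqueSums.uniqueAdd_of_one_lt_card h
    have key : ∀ r ∈ f.coeff.support ×ˢ g.coeff.support,
        UniqueAdd f.coeff.support g.coeff.support r.1 r.2 → r.1 + r.2 = 0 := by
      intro r hr hur
      rw [Finset.mem_product, Finsupp.mem_support_iff, Finsupp.mem_support_iff] at hr
      refine hsupp _ ?_
      rw [AddMonoidAlgebra.coeff_mul_add_of_uniqueAdd hur]
      exact mul_ne_zero hr.1 hr.2
    have h1 := Finset.mem_product.1 hp
    have h2 := hup (Finset.mem_product.1 hq).1 (Finset.mem_product.1 hq).2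
      ((key q hq huq).trans (key p hp hup).symm)
    exact hne (Prod.ext h2.1.symm h2.2.symm)
  have h1 : #f.coeff.support = 1 := by
    have h2 := hf0.card_pos
    have h3 := hg0.card_pos
    nlinarith
  obtain ⟨a, ha⟩ := Finset.card_eq_one.1 h1
  obtain ⟨hc, hfa⟩ := Finsupp.support_eq_singleton.1 ha
  exact ⟨a, _, hc, by ext; simp [← hfa]⟩

end Units

/-! ### Monomial prime ideals and the coordinate ring of the torus -/

section CoordRing

variable (K : Type u) [Field K] {N : Type u} [AddCommGroup N]

open Classical in
/-- For a lattice vector `v` in `σ`, the endomorphism of `K[S_σ]` that kills the characters `χ^m`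
with `⟨m, v⟩ ≠ 0` and fixes the others. -/
noncomputable def truncation {σ : PointedCone ℝ (RealSpace N)} {v : N} (hv : toReal v ∈ σ) :
    coordRing K σ →ₐ[K] coordRing K σ :=
  AddMonoidAlgebra.lift K (coordRing K σ) (dualMonoid σ)
    { toFun := fun m => if m.toAdd.1 v = 0 then .single m.toAdd 1 else 0
      map_one' := by simp [AddMonoidAlgebra.one_def]
      map_mul' := by
        intro m n
        have hm := dual_nonneg m.toAdd.2 hv
        have hn := dual_nonneg n.toAdd.2 hv
        have hmn : (m * n).toAdd.1 v = m.toAdd.1 v + n.toAdd.1 v := rfl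
        by_cases h1 : m.toAdd.1 v = 0
        · by_cases h2 : n.toAdd.1 v = 0
          · rw [if_pos h1, if_pos h2, if_pos (by rw [hmn, h1, h2, add_zero]),
              AddMonoidAlgebra.single_mul_single, mul_one]
            rfl
          · rw [if_neg h2, if_neg (by omega), mul_zero]
        · rw [if_neg h1, if_neg (by omega), zero_mul] }

variable {K} {σ : PointedCone ℝ (RealSpace N)} {v : N}

open Classical in
lemma truncation_single (hv : toReal v ∈ σ) (m : dualMonoid σ) (c : K) :
    truncation K hv (.single m c) = if m.1 v = 0 then .single m c else 0 := by
  rw [truncation, AddMonoidAlgebra.lift_single]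
  simp only [MonoidHom.coe_mk, OneHom.coe_mk, toAdd_ofAdd]
  split_ifs <;> simp

open Classical in
lemma coeff_truncation (hv : toReal v ∈ σ) (f : coordRing K σ) (m : dualMonoid σ) :
    (truncation K hv f).coeff m = if m.1 v = 0 then f.coeff m else 0 := by
  induction f using AddMonoidAlgebra.induction_linear with
  | zero => simp
  | add f g hf hg =>
    simp only [map_add, AddMonoidAlgebra.coeff_add, Finsupp.add_apply, hf, hg]
    split_ifs <;> simp
  | single n c =>
    rw [truncation_single]
    by_cases h : n = m
    · subst h
      split_ifs <;> simp
    · by_cases h1 : n.1 v = 0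
      · rw [if_pos h1]
        simp [h]
      · rw [if_neg h1]
        simp [h]

variable (K) in
/-- The ideal of `K[S_σ]` spanned by the characters `χ^m` with `⟨m, v⟩ > 0`. -/
noncomputable def faceIdeal (hv : toReal v ∈ σ) : Ideal (coordRing K σ) :=
  RingHom.ker (truncation K hv)

lemma mem_faceIdeal {hv : toReal v ∈ σ} {f : coordRing K σ} :
    f ∈ faceIdeal K hv ↔ ∀ m : dualMonoid σ, f.coeff m ≠ 0 → 0 < m.1 v := by
  classical
  rw [faceIdeal, RingHom.mem_ker]
  constructor
  · intro h m hm
    refine lt_of_le_of_ne (dual_nonneg m.2 hv) fun h0 => hm ?_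
    have h1 := coeff_truncation hv f m
    rw [if_pos h0.symm, h] at h1
    exact h1.symm
  · intro h
    ext m
    rw [coeff_truncation]
    split_ifs with h0
    · by_contra h1
      exact (h m h1).ne' h0
    · rfl

lemma single_mem_faceIdeal {hv : toReal v ∈ σ} {m : dualMonoid σ} :
    (.single m 1 : coordRing K σ) ∈ faceIdeal K hv ↔ 0 < m.1 v := by
  classical
  rw [mem_faceIdeal]
  constructor
  · intro h
    exact h m (by simp)
  · intro h n hn
    by_cases hmn : m = n
    · exact hmn ▸ h
    · simp [hmn] at hn

lemma faceIdeal_le {hv : toReal v ∈ σ} {I : Ideal (coordRing K σ)}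
    (h : ∀ m : dualMonoid σ, 0 < m.1 v → (.single m 1 : coordRing K σ) ∈ I) :
    faceIdeal K hv ≤ I := by
  intro f hf
  rw [mem_faceIdeal] at hf
  rw [← AddMonoidAlgebra.sum_coeff_single f]
  refine Submodule.sum_mem _ fun m hm => ?_
  have h1 : (.single m (f.coeff m) : coordRing K σ) = f.coeff m • .single m 1 := by simp
  rw [h1]
  exact Submodule.smul_of_tower_mem I _ (h m (hf m (Finsupp.mem_support_iff.1 hm)))

lemma mem_dualMonoid_hull_singleton {m : Module.Dual ℤ N} :
    m ∈ dualMonoid (PointedCone.hull ℝ {toReal v}) ↔ 0 ≤ m v := by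
  rw [← Set.image_singleton, mem_dualMonoid_hull]
  simp

/-- The ideal of the divisor of a ray is principal. -/
lemma faceIdeal_hull_singleton (hv : toReal v ∈ PointedCone.hull ℝ {toReal v})
    {m : dualMonoid (PointedCone.hull ℝ {toReal v})} (hm : m.1 v = 1) :
    faceIdeal K hv = Ideal.span {.single m 1} := by
  refine le_antisymm (faceIdeal_le fun n hn => ?_) ?_
  · have hmem : n.1 - m.1 ∈ dualMonoid (PointedCone.hull ℝ {toReal v}) := by
      rw [mem_dualMonoid_hull_singleton, LinearMap.sub_apply, hm]
      omega
    refine Ideal.mem_span_singleton.2 ⟨.single ⟨_, hmem⟩ 1, ?_⟩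
    rw [AddMonoidAlgebra.single_mul_single, mul_one]
    congr 1
    ext1
    simp
  · rw [Ideal.span_singleton_le_iff_mem, single_mem_faceIdeal, hm]
    exact one_pos

variable [Module.Free ℤ N] [Module.Finite ℤ N]

/-- It is the kernel of an endomorphism of a domain. -/
instance faceIdeal_isPrime (hv : toReal v ∈ σ) : (faceIdeal K hv).IsPrime :=
  RingHom.ker_isPrime _

variable (K N) in
/-- The coordinate ring of the torus is a unique factorization domain. -/
instance uniqueFactorizationMonoid_coordRing_bot :
    UniqueFactorizationMonoid (coordRing K (⊥ : PointedCone ℝ (RealSpace N))) := by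
  classical
  -- The cone on a basis of N has a polynomial ring as coordinate ring. The sum of the coordinate
  -- forms cuts out its zero face, so K[M] is a localization of that polynomial ring.
  let ι := Module.Free.ChooseBasisIndex ℤ N
  let b := Module.Free.chooseBasis ℤ N
  let s : Finset N := Finset.univ.image b
  let σ := PointedCone.hull ℝ (toReal '' (s : Set N))
  have hσ : ∀ m, m ∈ dualMonoid σ ↔ ∀ i, 0 ≤ m (b i) := by
    intro m
    rw [mem_dualMonoid_hull]
    simp [s]
  let e : dualMonoid σ ≃+ (ι →₀ ℕ) :=
    { toFun := fun m => Finsupp.equivFunOnFinite.symm fun i => (m.1 (b i)).toNat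
      invFun := fun p => ⟨b.constr ℤ fun i => (p i : ℤ), by
        rw [hσ]
        intro i
        rw [Module.Basis.constr_basis]
        positivity⟩
      left_inv := by
        intro m
        ext1
        refine b.ext fun i => ?_
        rw [Module.Basis.constr_basis]
        exact Int.toNat_of_nonneg ((hσ _).1 m.2 i)
      right_inv := by
        intro p
        ext i
        simp
      map_add' := by
        intro m n
        ext i
        exact Int.toNat_add ((hσ _).1 m.2 i) ((hσ _).1 n.2 i) }
  have hufd : UniqueFactorizationMonoid (coordRing K σ) :=
    (AddMonoidAlgebra.domCongr K K e).symm.toMulEquiv.uniqueFactorizationMonoid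
      (inferInstanceAs (UniqueFactorizationMonoid (MvPolynomial ι K)))
  let m : Module.Dual ℤ N := ∑ i, b.coord i
  have hmb : ∀ i, m (b i) = 1 := by
    intro i
    simp [m, LinearMap.sum_apply, Finsupp.single_apply]
  have hm : m ∈ dualMonoid σ := (hσ m).2 fun i => by rw [hmb]; exact zero_le_one
  have hle : (⊥ : PointedCone ℝ (RealSpace N)) ≤ σ := bot_le
  have hτ : ∀ x, x ∈ (⊥ : PointedCone ℝ (RealSpace N)) ↔ x ∈ σ ∧ pairing m x = 0 := by
    intro x
    constructor
    · rintro rfl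
      exact ⟨zero_mem _, map_zero _⟩
    · rintro ⟨hx, h0⟩
      refine eq_zero_of_mem_hull (m := m) ?_ hx h0
      intro v hv _
      obtain ⟨i, -, rfl⟩ := Finset.mem_image.1 (Finset.mem_coe.1 hv)
      rw [hmb]
      exact one_pos
  let _ := (coordMap K hle).toAlgebra
  have := isLocalization_coordMap K ⟨s, rfl⟩ hle hm hτ
  exact UniqueFactorizationMonoid.of_isLocalization
    (Submonoid.powers (.single ⟨m, hm⟩ 1 : coordRing K σ)) _

lemma twoUniqueSums_dualMonoid (σ : PointedCone ℝ (RealSpace N)) :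
    TwoUniqueSums (dualMonoid σ) := by
  let b := Module.Free.chooseBasis ℤ (Module.Dual ℤ N)
  exact .of_injective_addHom
    (b.repr.toLinearMap.toAddMonoidHom.comp (dualMonoid σ).subtype).toAddHom
    (b.repr.injective.comp Subtype.val_injective) inferInstance

end CoordRing

/-! ### Orders of vanishing computed in an affine chart -/

section FunctionField

variable {X : Scheme.{u}} {R : CommRingCat.{u}} (f : Spec R ⟶ X) [IsOpenImmersion f]

/-- The map from `R` to the sections of `X` over the affine open image of `Spec R`. -/
noncomputable def toSections : R ⟶ Γ(X, f ''ᵁ ⊤) :=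
  (Scheme.ΓSpecIso R).inv ≫ (f.appIso ⊤).inv

instance : IsIso (toSections f) := by
  unfold toSections
  infer_instance

lemma mem_image_top (p : Spec R) : f p ∈ f ''ᵁ ⊤ := ⟨p, trivial, rfl⟩

/-- The map from `R` to the stalk of `X` at a point of `Spec R`. -/
noncomputable def toStalkAt (p : Spec R) : R ⟶ X.presheaf.stalk (f p) :=
  toSections f ≫ X.presheaf.germ (f ''ᵁ ⊤) (f p) (mem_image_top f p)

lemma toStalkAt_stalkMap (p : Spec R) :
    toStalkAt f p ≫ f.stalkMap p = StructureSheaf.toStalk R p := by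
  rw [toStalkAt, Category.assoc, Scheme.Hom.germ_stalkMap]
  simp only [toSections, Category.assoc]
  rw [Scheme.Hom.appIso_inv_app_assoc]
  exact congrArg (_ ≫ ·) (TopCat.Presheaf.germ_res _ _ _ _)

/-- An open immersion induces isomorphisms on stalks, so the statement is transported from the
structure sheaf of `Spec R`. -/
lemma isLocalization_toStalkAt (p : Spec R) :
    @IsLocalization.AtPrime R _ (X.presheaf.stalk (f p)) _ (toStalkAt f p).hom.toAlgebra
      p.asIdeal p.2 := by
  have : p.asIdeal.IsPrime := p.2
  let _ := (toStalkAt f p).hom.toAlgebra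
  refine (IsLocalization.isLocalization_iff_of_ringEquiv (R := R) p.asIdeal.primeCompl
      (asIso (f.stalkMap p)).commRingCatIsoToRingEquiv).mpr ?_
  have h : ((asIso (f.stalkMap p)).commRingCatIsoToRingEquiv.toRingHom.comp
      (algebraMap R (X.presheaf.stalk (f p)))) = (StructureSheaf.toStalk R p).hom :=
    congrArg CommRingCat.Hom.hom (toStalkAt_stalkMap f p)
  rw [h]
  exact StructureSheaf.IsLocalization.to_stalk R p

lemma isUnit_toStalkAt {p : Spec R} {a : R} (ha : a ∉ p.asIdeal) :
    IsUnit ((toStalkAt f p).hom a) := by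
  have : p.asIdeal.IsPrime := p.2
  let _ := (toStalkAt f p).hom.toAlgebra
  have := isLocalization_toStalkAt f p
  exact IsLocalization.map_units _ (⟨a, ha⟩ : p.asIdeal.primeCompl)

lemma maximalIdeal_stalk_eq_map (p : Spec R) :
    IsLocalRing.maximalIdeal (X.presheaf.stalk (f p)) = p.asIdeal.map (toStalkAt f p).hom := by
  have : p.asIdeal.IsPrime := p.2
  let _ := (toStalkAt f p).hom.toAlgebra
  have := isLocalization_toStalkAt f p
  exact (IsLocalization.AtPrime.map_eq_maximalIdeal p.asIdeal _).symm

lemma height_eq_coheight (p : Spec R) : p.asIdeal.height = Order.coheight (f p) := by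
  have h1 : p.asIdeal.height = Order.coheight p := idealHeight_eq_coheight R p
  have h2 : Order.coheight (f p) = Order.coheight p :=
    coheight_eq_of_isOpenImmersion f
  rw [h1, h2]

variable [IsIntegral X] [Nonempty (PrimeSpectrum R)]

instance : Nonempty (f ''ᵁ ⊤ : X.Opens) :=
  ⟨⟨_, mem_image_top f (Classical.arbitrary (PrimeSpectrum R))⟩⟩

/-- The embedding of the coordinate ring of an affine open subscheme into the function field. -/
noncomputable def toFunctionField : R →+* X.functionField :=
  (toSections f ≫ X.germToFunctionField (f ''ᵁ ⊤)).hom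

lemma algebraMap_toStalkAt (p : Spec R) (a : R) :
    algebraMap (X.presheaf.stalk (f p)) X.functionField ((toStalkAt f p).hom a) =
      toFunctionField f a :=
  Scheme.algebraMap_germ_eq_germToFunctionField X (mem_image_top f p) _

lemma toFunctionField_injective : Function.Injective (toFunctionField f) := by
  have h1 : Function.Injective (toSections f) :=
    ((ConcreteCategory.isIso_iff_bijective _).1 inferInstance).1
  exact (Scheme.germToFunctionField_injective X (f ''ᵁ ⊤)).comp h1

lemma exists_eq_div_toFunctionField (g : X.functionField) :
    ∃ a b : R, b ≠ 0 ∧ g = toFunctionField f a / toFunctionField f b := by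
  have hU : IsAffineOpen (f ''ᵁ ⊤) := (isAffineOpen_top _).image_of_isOpenImmersion f
  have := functionField_isFractionRing_of_isAffineOpen X _ hU
  obtain ⟨a, b, hb, rfl⟩ := IsFractionRing.div_surjective (A := Γ(X, f ''ᵁ ⊤)) g
  have hsurj : Function.Surjective (toSections f) :=
    ((ConcreteCategory.isIso_iff_bijective _).1 inferInstance).2
  obtain ⟨a, rfl⟩ := hsurj a
  obtain ⟨b, rfl⟩ := hsurj b
  refine ⟨a, b, ?_, rfl⟩
  rintro rfl
  exact nonZeroDivisors.ne_zero hb (map_zero (toSections f).hom)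

/-- Lets one rational function be evaluated in whichever chart is convenient. -/
lemma toFunctionField_comp {S : CommRingCat.{u}} [Nonempty (PrimeSpectrum S)] (φ : R ⟶ S)
    (g : Spec S ⟶ X) [IsOpenImmersion g] (h : Spec.map φ ≫ f = g) (a : R) :
    toFunctionField g (φ a) = toFunctionField f a := by
  subst h
  have hle : (Spec.map φ ≫ f) ''ᵁ ⊤ ≤ f ''ᵁ ⊤ := by
    rintro _ ⟨p, -, rfl⟩
    exact ⟨Spec.map φ p, trivial, rfl⟩
  have h1 : toSections f ≫ X.presheaf.map (homOfLE hle).op = φ ≫ toSections (Spec.map φ ≫ f) := by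
    rw [← cancel_mono ((Spec.map φ ≫ f).appIso ⊤).hom]
    simp only [toSections, Category.assoc, Iso.inv_hom_id, Category.comp_id]
    rw [Scheme.ΓSpecIso_inv_naturality, Scheme.Hom.appIso_hom', Scheme.Hom.map_appLE]
    rw [← Scheme.Hom.appLE_comp_appLE (Spec.map φ) f (f ''ᵁ ⊤) ⊤ ⊤
      (f.preimage_image_eq ⊤).ge le_rfl, ← Scheme.Hom.appIso_hom', Iso.inv_hom_id_assoc,
      Scheme.Hom.appTop, Scheme.Hom.app_eq_appLE]
    rfl
  have h2 : toSections f ≫ X.germToFunctionField (f ''ᵁ ⊤) =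
      φ ≫ toSections (Spec.map φ ≫ f) ≫ X.germToFunctionField ((Spec.map φ ≫ f) ''ᵁ ⊤) := by
    rw [← Category.assoc φ, ← h1, Category.assoc]
    simp only [Scheme.germToFunctionField, TopCat.Presheaf.germ_res]
  exact congr($h2 a).symm

variable [IsNoetherian X]

/-- `a` is a unit in the local ring. At points of codimension other than one, `X.ord` is zero by
convention. -/
lemma ord_toFunctionField_of_notMem {p : Spec R} {a : R} (ha : a ∉ p.asIdeal) :
    X.ord (toFunctionField f a) (f p) = 0 := by
  by_cases hp : Order.coheight (f p) = 1
  · have : Ring.KrullDimLE 1 (X.presheaf.stalk (f p)) := krullDimLE_of_coheight_le hp.le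
    have h0 : toFunctionField f a ≠ 0 := by
      rw [map_ne_zero_iff _ (toFunctionField_injective f)]
      rintro rfl
      exact ha (zero_mem _)
    rw [Scheme.ord_eq_iff hp h0, ← algebraMap_toStalkAt f p]
    exact Ring.ordFrac_of_isUnit (isUnit_toStalkAt f ha)
  · exact Scheme.ord_eq_zero_of_coheight_neq_one hp _

lemma ord_toFunctionField_nonneg (p : Spec R) {a : R} (ha : a ≠ 0) :
    0 ≤ X.ord (toFunctionField f a) (f p) := by
  by_cases hp : Order.coheight (f p) = 1
  · have : Ring.KrullDimLE 1 (X.presheaf.stalk (f p)) := krullDimLE_of_coheight_le hp.le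
    have h0 : toFunctionField f a ≠ 0 := (map_ne_zero_iff _ (toFunctionField_injective f)).2 ha
    rw [Scheme.le_ord_iff hp h0, ← algebraMap_toStalkAt f p]
    refine Ring.ordFrac_ge_one_of_ne_zero fun h => h0 ?_
    rw [← algebraMap_toStalkAt f p, h, map_zero]
  · rw [Scheme.ord_eq_zero_of_coheight_neq_one hp]

/-- `a` generates the maximal ideal of the local ring, so the quotient by `a` is the residue field,
of length 1. -/
lemma ord_toFunctionField_of_span_eq {p : Spec R} (hp : p.asIdeal.height = 1) {a : R}
    (ha : p.asIdeal = Ideal.span {a}) : X.ord (toFunctionField f a) (f p) = 1 := by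
  rw [height_eq_coheight f] at hp
  have : Ring.KrullDimLE 1 (X.presheaf.stalk (f p)) := krullDimLE_of_coheight_le hp.le
  have ha0 : a ≠ 0 := by
    rintro rfl
    have := (toFunctionField_injective f).isDomain
    rw [← height_eq_coheight f] at hp
    exact Ideal.ne_bot_of_height_eq_one hp (by simpa using ha)
  have h0 : toFunctionField f a ≠ 0 := (map_ne_zero_iff _ (toFunctionField_injective f)).2 ha0
  have hs0 : (toStalkAt f p).hom a ≠ 0 := by
    intro h
    refine h0 ?_
    rw [← algebraMap_toStalkAt f p, h, map_zero]
  rw [Scheme.ord_eq_iff hp h0, ← algebraMap_toStalkAt f p]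
  have hmax : IsLocalRing.maximalIdeal (X.presheaf.stalk (f p)) =
      Ideal.span {(toStalkAt f p).hom a} := by
    rw [maximalIdeal_stalk_eq_map, ha, Ideal.map_span, Set.image_singleton]
  have hord : Ring.ord (X.presheaf.stalk (f p)) ((toStalkAt f p).hom a) = 1 := by
    rw [Ring.ord, ← hmax, Module.length_eq_one_iff, isSimpleModule_iff_isCoatom]
    exact (IsLocalRing.maximalIdeal.isMaximal _).out
  change Ring.ordFrac _ _ = _
  rw [Ring.ordFrac_eq_ord _ hs0, Ring.ordMonoidWithZeroHom_eq_coe _ (by simpa) (n := 1) (by simpa using hord)]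
  rfl

end FunctionField

/-! ### Primes of height one -/

lemma eq_of_le_of_height_eq_one {R : Type*} [CommRing R] [IsDomain R] {q p : Ideal R} [q.IsPrime]
    [p.IsPrime] (hq : q ≠ ⊥) (hle : q ≤ p) (hp : p.height = 1) : q = p := by
  by_contra hne
  have : p.FiniteHeight := by simp [p.finiteHeight_iff, hp]
  have : q.FiniteHeight := Ideal.finiteHeight_of_le hle Ideal.IsPrime.ne_top'
  have h := Ideal.height_strict_mono_of_isPrime_of_isPrime (lt_of_le_of_ne hle hne)
  rw [hp, Order.lt_one_iff, Ideal.height_eq_zero_iff_eq_bot] at h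
  exact hq h

lemma height_eq_one_of_eq_span {R : Type*} [CommRing R] [IsDomain R] [IsNoetherianRing R]
    {p : Ideal R} [p.IsPrime] {a : R} (ha : a ≠ 0) (h : p = Ideal.span {a}) : p.height = 1 := by
  refine le_antisymm ?_ ?_
  · have : p.IsPrincipal := ⟨a, h⟩
    exact Ideal.height_le_one_of_isPrincipal_of_mem_minimalPrimes p p (by
      rw [Ideal.minimalPrimes_eq_subsingleton_self]
      rfl)
  · rw [Order.one_le_iff_pos, pos_iff_ne_zero, Ne, Ideal.height_eq_zero_iff_eq_bot, h,
      Ideal.span_singleton_eq_bot]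
    exact ha

/-- The order of vanishing at a point as a homomorphism on nonzero rational functions. -/
noncomputable def ordUnits {X : Scheme.{u}} [IsIntegral X] [IsNoetherian X] (x : X) :
    Additive (X.functionField)ˣ →+ ℤ where
  toFun g := X.ord (g.toMul : X.functionField) x
  map_zero' := ord_one X x
  map_add' g h := Scheme.ord_mul g.toMul.ne_zero h.toMul.ne_zero

lemma exists_mem_dualMonoid_pos {N : Type u} [AddCommGroup N] [Module.Free ℤ N]
    [Module.Finite ℤ N] {σ : PointedCone ℝ (RealSpace N)} (hσ : IsRationalPolyhedral σ)
    (hsc : ∀ x ∈ σ, -x ∈ σ → x = 0) {v : N} (hv : toReal v ∈ σ) (hv0 : toReal v ≠ 0) :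
    ∃ m ∈ dualMonoid σ, 0 < m v := by
  obtain ⟨s, rfl⟩ := hσ
  obtain ⟨m, hm⟩ := exists_dual_pos s hsc
  have hmem := mem_dualMonoid_of_pos hm
  refine ⟨m, hmem, lt_of_le_of_ne (dual_nonneg hmem hv) fun h => hv0 ?_⟩
  exact eq_zero_of_mem_hull hm hv (by rw [pairing_toReal, ← h, Int.cast_zero])

lemma mem_dualMonoid_bot {N : Type u} [AddCommGroup N] (m : Module.Dual ℤ N) :
    m ∈ dualMonoid (⊥ : PointedCone ℝ (RealSpace N)) := by
  rintro x rfl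
  rw [map_zero]

/-! ### Characters and the divisors of the rays -/

namespace Fan

variable {N : Type u} [AddCommGroup N] (F : Fan N)

/-- The primitive generators of the rays. -/
def rayGenerators : Set N := {v | ∃ ρ ∈ F.rays, IsPrimitiveGenerator v ρ}

/-- The ray spanned by a primitive generator. -/
def rayCone (v : F.rayGenerators) : F.cones := ⟨PointedCone.hull ℝ {toReal v.1}, by
  obtain ⟨v, ρ, hρ, hv⟩ := v
  exact hv.2 ▸ hρ.1⟩

lemma toReal_mem_rayCone (v : F.rayGenerators) : toReal v.1 ∈ (F.rayCone v).1 :=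
  Submodule.subset_span rfl

lemma mem_dualMonoid_rayCone {v : F.rayGenerators} {m : Module.Dual ℤ N} (hm : 0 ≤ m v.1) :
    m ∈ dualMonoid (F.rayCone v).1 := mem_dualMonoid_hull_singleton.2 hm

variable [Module.Free ℤ N] [Module.Finite ℤ N] (K : Type u) [Field K]

/-- The zero cone of a fan. -/
def botCone : F.cones := ⟨⊥, F.bot_mem⟩

lemma botCone_le (σ : F.cones) : F.botCone.1 ≤ σ.1 := bot_le

/-- The embedding of `K[S_σ]` into the function field of the toric variety. -/
noncomputable def rat (σ : F.cones) : coordRing K σ.1 →+* (F.toricVariety K).functionField :=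
  toFunctionField (F.chart K σ)

lemma rat_injective (σ : F.cones) : Function.Injective (F.rat K σ) :=
  toFunctionField_injective _

lemma rat_coordMap {σ τ : F.cones} (h : τ.1 ≤ σ.1) (f : coordRing K σ.1) :
    F.rat K τ (coordMap K h f) = F.rat K σ f :=
  toFunctionField_comp (F.chart K σ) (CommRingCat.ofHom (coordMap K h)) (F.chart K τ)
    (F.chart_comp K h) f

/-- The character `χ^m` as a rational function. -/
noncomputable def character (m : Module.Dual ℤ N) : (F.toricVariety K).functionField :=
  F.rat K F.botCone (.single ⟨m, mem_dualMonoid_bot m⟩ 1)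

lemma rat_single (σ : F.cones) (m : dualMonoid σ.1) :
    F.rat K σ (.single m 1) = F.character K m.1 := by
  rw [character, ← F.rat_coordMap K (F.botCone_le σ), coordMap_single]
  rfl

lemma character_ne_zero (m : Module.Dual ℤ N) : F.character K m ≠ 0 := by
  rw [character, map_ne_zero_iff _ (F.rat_injective K _)]
  simp

lemma character_add (m n : Module.Dual ℤ N) :
    F.character K (m + n) = F.character K m * F.character K n := by
  rw [character, character, character, ← map_mul, AddMonoidAlgebra.single_mul_single, mul_one]
  rfl

/-- The order of vanishing of the characters at a point. -/
noncomputable def ordCharacter (x : F.toricVariety K) : Module.Dual ℤ N →+ ℤ where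
  toFun m := (F.toricVariety K).ord (F.character K m) x
  map_zero' := by
    have h := Scheme.ord_mul (x := x) (F.character_ne_zero K 0) (F.character_ne_zero K 0)
    rw [← character_add, add_zero] at h
    omega
  map_add' m n := by
    rw [character_add, Scheme.ord_mul (F.character_ne_zero K m) (F.character_ne_zero K n)]

lemma ord_rat_of_isUnit {σ : F.cones} {f : coordRing K σ.1} (hf : IsUnit f)
    (p : affineToric K σ.1) : (F.toricVariety K).ord (F.rat K σ f) (F.chart K σ p) = 0 :=
  ord_toFunctionField_of_notMem (F.chart K σ) fun h => p.2.ne_top (Ideal.eq_top_of_isUnit_mem _ h hf)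

/-- A constant is the same rational function in every chart, so it can be tested in a chart
containing `x`, where it is a unit. -/
lemma ord_rat_single_zero {c : K} (hc : c ≠ 0) (σ : F.cones) (x : F.toricVariety K) :
    (F.toricVariety K).ord (F.rat K σ (.single 0 c)) x = 0 := by
  have hbot : ∀ τ : F.cones, F.rat K τ (.single 0 c) = F.rat K F.botCone (.single 0 c) := by
    intro τ
    rw [← F.rat_coordMap K (F.botCone_le τ), coordMap_single, map_zero]
  obtain ⟨τ, p, rfl⟩ := F.exists_chart_eq K x
  rw [hbot σ, ← hbot τ]
  refine F.ord_rat_of_isUnit K (IsUnit.of_mul_eq_one (.single 0 c⁻¹) ?_) p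
  rw [AddMonoidAlgebra.single_mul_single, add_zero, mul_inv_cancel₀ hc, AddMonoidAlgebra.one_def]

lemma ord_character_torus (m : Module.Dual ℤ N) (p : affineToric K F.botCone.1) :
    (F.toricVariety K).ord (F.character K m) (F.chart K F.botCone p) = 0 := by
  refine F.ord_rat_of_isUnit K (IsUnit.of_mul_eq_one
    (.single ⟨-m, mem_dualMonoid_bot (-m)⟩ 1) ?_) p
  rw [AddMonoidAlgebra.single_mul_single, AddMonoidAlgebra.one_def, mul_one]
  congr 1
  ext1
  simp

instance : Finite F.rayGenerators := by
  have : Finite F.cones := F.finite.to_subtype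
  choose ρ hρ hv using fun v : F.rayGenerators => v.2
  refine Finite.of_injective (fun v => (⟨ρ v, (hρ v).1⟩ : F.cones)) fun v w h => Subtype.ext ?_
  have h1 : ρ v = ρ w := congrArg Subtype.val h
  exact (hv v).eq (h1 ▸ hv w)

lemma exists_apply_eq_one (v : F.rayGenerators) : ∃ m : Module.Dual ℤ N, m v.1 = 1 := by
  obtain ⟨v, ρ, hρ, hv⟩ := v
  exact hv.1.exists_apply_eq_one

/-- The generic point, in the chart of the ray, of the divisor of a ray. -/
noncomputable def rayPrime (v : F.rayGenerators) : affineToric K (F.rayCone v).1 :=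
  (⟨faceIdeal K (F.toReal_mem_rayCone v), faceIdeal_isPrime _⟩ : PrimeSpectrum _)

lemma asIdeal_rayPrime {v : F.rayGenerators} {m : dualMonoid (F.rayCone v).1} (hm : m.1 v.1 = 1) :
    (F.rayPrime K v).asIdeal = Ideal.span {.single m 1} :=
  faceIdeal_hull_singleton (F.toReal_mem_rayCone v) hm

lemma height_rayPrime (v : F.rayGenerators) : (F.rayPrime K v).asIdeal.height = 1 := by
  obtain ⟨m, hm⟩ := F.exists_apply_eq_one v
  have : (F.rayPrime K v).asIdeal.IsPrime := (F.rayPrime K v).2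
  refine height_eq_one_of_eq_span (R := coordRing K (F.rayCone v).1) ?_ (F.asIdeal_rayPrime K
    (m := ⟨m, F.mem_dualMonoid_rayCone (hm ▸ zero_le_one)⟩) hm)
  simp

/-- The generic point of the divisor of a ray. -/
noncomputable def rayPoint (v : F.rayGenerators) : F.toricVariety K :=
  F.chart K (F.rayCone v) (F.rayPrime K v)

lemma coheight_rayPoint (v : F.rayGenerators) : Order.coheight (F.rayPoint K v) = 1 := by
  rw [rayPoint, ← height_eq_coheight, height_rayPrime]

/-- The character `χ^m` vanishes to order `⟨m, v⟩` along the divisor of the ray generated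
by `v`. -/
lemma ord_character_rayPoint (m : Module.Dual ℤ N) (v : F.rayGenerators) :
    (F.toricVariety K).ord (F.character K m) (F.rayPoint K v) = m v.1 := by
  obtain ⟨m₁, hm₁⟩ := F.exists_apply_eq_one v
  have h1 : F.ordCharacter K (F.rayPoint K v) m₁ = 1 := by
    have hmem := F.mem_dualMonoid_rayCone (v := v) (m := m₁) (hm₁ ▸ zero_le_one)
    change (F.toricVariety K).ord (F.character K m₁) _ = 1
    rw [← F.rat_single K (F.rayCone v) ⟨m₁, hmem⟩]
    exact ord_toFunctionField_of_span_eq (F.chart K (F.rayCone v)) (F.height_rayPrime K v)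
      (F.asIdeal_rayPrime K hm₁)
  have h2 : ∀ n : Module.Dual ℤ N, n v.1 = 0 → F.ordCharacter K (F.rayPoint K v) n = 0 := by
    intro n hn
    have hmem := F.mem_dualMonoid_rayCone (v := v) (m := n) hn.ge
    change (F.toricVariety K).ord (F.character K n) _ = 0
    rw [← F.rat_single K (F.rayCone v) ⟨n, hmem⟩]
    refine ord_toFunctionField_of_notMem (F.chart K (F.rayCone v)) ?_
    intro h
    exact (single_mem_faceIdeal.1 h).ne' hn
  -- `χ^{m₁}` is a uniformizer at the ray, while characters orthogonal to `v` are units there.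
  have h3 : m = m v.1 • m₁ + (m - m v.1 • m₁) := by abel
  change F.ordCharacter K (F.rayPoint K v) m = m v.1
  rw [h3, map_add, map_zsmul, h1, h2 _ (by simp [hm₁]), ← h3]
  simp

lemma rayPoint_injective : Function.Injective (F.rayPoint K) := by
  intro v w h
  refine Subtype.ext (eq_of_forall_dual_apply_eq fun m => ?_)
  rw [← F.ord_character_rayPoint K m v, h, F.ord_character_rayPoint]

lemma rayPoint_ne_chart (v : F.rayGenerators) (p : affineToric K F.botCone.1) :
    F.rayPoint K v ≠ F.chart K F.botCone p := by
  intro h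
  obtain ⟨m, hm⟩ := F.exists_apply_eq_one v
  have h1 := F.ord_character_rayPoint K m v
  rw [h, F.ord_character_torus, hm] at h1
  exact zero_ne_one h1

/-! ### Classification of the prime divisors -/

/-- A prime divisor of a toric variety that does not meet the torus is the divisor of a ray. -/
lemma exists_chart_or_rayPoint {x : F.toricVariety K} (hx : Order.coheight x = 1) :
    (∃ p : affineToric K F.botCone.1, F.chart K F.botCone p = x) ∨
      ∃ v : F.rayGenerators, F.rayPoint K v = x := by
  have hfin : Finite F.cones := F.finite.to_subtype
  -- A minimal cone whose chart contains `x`. If `χ^m` is invertible at `x`, then `x` lies in the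
  -- chart of the face `σ ∩ m^⊥`, which minimality forces to be `σ`. So `p` contains every character
  -- positive somewhere on the lattice points of `σ`.
  obtain ⟨σ, ⟨p, hp⟩, hmin⟩ := (Set.toFinite {σ : F.cones | ∃ p, F.chart K σ p = x}).exists_minimal
    (F.exists_chart_eq K x)
  have hheight : p.asIdeal.height = 1 := by
    rw [height_eq_coheight (F.chart K σ), hp, hx]
  have hprime : p.asIdeal.IsPrime := p.2
  have hmem : ∀ (m : dualMonoid σ.1) (w : N), toReal w ∈ σ.1 → 0 < m.1 w →
      (.single m 1 : coordRing K σ.1) ∈ p.asIdeal := by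
    intro m w hw hpos
    by_contra hnot
    let τ : F.cones := ⟨_, F.faceOf_mem σ.2 m.2⟩
    have hle : τ.1 ≤ σ.1 := faceOf_le _ _
    have h1 : p ∈ Set.range (affineToricMap K hle) := by
      rw [range_affineToricMap K (F.rational _ σ.2) hle m.2 fun _ => Iff.rfl]
      exact hnot
    obtain ⟨q, hq⟩ := h1
    have h2 : F.chart K τ q = x := by
      rw [← hp, ← hq]
      exact congr($(F.chart_comp K (σ := σ) (τ := τ) hle) q).symm
    have h3 : σ.1 ≤ τ.1 := hmin ⟨q, h2⟩ hle
    have h4 := (h3 hw).2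
    rw [pairing_toReal] at h4
    have h5 : m.1 w = 0 := by exact_mod_cast h4
    omega
  obtain ⟨σ, hσ⟩ := σ
  by_cases hbot : σ = ⊥
  · subst hbot
    exact Or.inl ⟨p, hp⟩
  have hface_ne : ∀ {v : N} (hv : toReal v ∈ σ), toReal v ≠ 0 → faceIdeal K hv ≠ ⊥ := by
    intro v hv hv0 h
    obtain ⟨n, hn, hnv⟩ := exists_mem_dualMonoid_pos (F.rational σ hσ) (F.stronglyConvex σ hσ)
      hv hv0
    have h1 : (.single ⟨n, hn⟩ 1 : coordRing K σ) ∈ faceIdeal K hv := single_mem_faceIdeal.2 hnv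
    rw [h, Ideal.mem_bot] at h1
    simp at h1
  by_cases hray : Module.finrank ℝ (Submodule.span ℝ (σ : Set (RealSpace N))) = 1
  · right
    obtain ⟨v, hv⟩ := exists_isPrimitiveGenerator (F.rational σ hσ) (F.stronglyConvex σ hσ) hray
    let w : F.rayGenerators := ⟨v, σ, ⟨hσ, hray⟩, hv⟩
    obtain ⟨hv, rfl⟩ := hv
    have hvσ : toReal v ∈ PointedCone.hull ℝ {toReal v} := Submodule.subset_span rfl
    have h0 : toReal v ≠ 0 := fun h => hv.ne_zero (toReal_injective (h.trans toReal_zero.symm))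
    have h1 : faceIdeal K hvσ = p.asIdeal :=
      eq_of_le_of_height_eq_one (hface_ne hvσ h0) (faceIdeal_le fun m hm => hmem m v hvσ hm) hheight
    have h2 : F.rayPrime K w = p := PrimeSpectrum.ext h1
    exact ⟨w, (congrArg (F.chart K (F.rayCone w)) h2).trans hp⟩
  -- In dimension at least two, take `v` nonzero on a proper face and `w` off it. Then `0 ≠
  -- faceIdeal v ⊊ faceIdeal (v + w) ≤ p`, which is impossible in height one.
  · exfalso
    obtain ⟨m, hm, v, w, hv, hw, hv0, hmv, hmw⟩ := exists_face_of_finrank_ne_one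
      (F.rational σ hσ) (F.stronglyConvex σ hσ) hbot hray
    have hvw : toReal (v + w) ∈ σ := by
      rw [toReal_add]
      exact add_mem hv hw
    have h1 : faceIdeal K hv ≤ faceIdeal K hvw := faceIdeal_le fun n hn => by
      rw [single_mem_faceIdeal, map_add]
      have := dual_nonneg n.2 hw
      omega
    have h2 : faceIdeal K hvw ≤ p.asIdeal := faceIdeal_le fun n hn => hmem n _ hvw hn
    have h3 := eq_of_le_of_height_eq_one (hface_ne hv hv0) (h1.trans h2) hheight
    have h4 : (.single ⟨m, hm⟩ 1 : coordRing K σ) ∈ faceIdeal K hv := by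
      rw [h3]
      refine h2 (single_mem_faceIdeal.2 ?_)
      change 0 < m (v + w)
      rwa [map_add, hmv, zero_add]
    exact (single_mem_faceIdeal.1 h4).ne' hmv

/-! ### Divisors and invertible functions on the torus -/

instance : UniqueFactorizationMonoid (coordRing K F.botCone.1) :=
  uniqueFactorizationMonoid_coordRing_bot K N

/-- The divisor `∑ c_v D_v` supported on the complement of the torus. -/
noncomputable def rayDivisor : (F.rayGenerators → ℤ) →+ WeilDivisor (F.toricVariety K) :=
  (Finsupp.mapDomain.addMonoidHom fun v => ⟨F.rayPoint K v, F.coheight_rayPoint K v⟩).comp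
    (Finsupp.linearEquivFunOnFinite ℤ ℤ F.rayGenerators).symm.toLinearMap.toAddMonoidHom

lemma rayDivisor_rayPoint (c : F.rayGenerators → ℤ) (v : F.rayGenerators) :
    F.rayDivisor K c ⟨F.rayPoint K v, F.coheight_rayPoint K v⟩ = c v := by
  have hinj : Function.Injective fun v => (⟨F.rayPoint K v, F.coheight_rayPoint K v⟩ :
      {x : F.toricVariety K // Order.coheight x = 1}) :=
    fun v w h => F.rayPoint_injective K (congrArg Subtype.val h)
  exact Finsupp.mapDomain_apply hinj _ v

lemma rayDivisor_chart (c : F.rayGenerators → ℤ) (p : affineToric K F.botCone.1)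
    (hp : Order.coheight (F.chart K F.botCone p) = 1) :
    F.rayDivisor K c ⟨F.chart K F.botCone p, hp⟩ = 0 := by
  refine Finsupp.mapDomain_of_notMem_range _ _ ?_
  rintro ⟨v, hv⟩
  exact F.rayPoint_ne_chart K v p (congrArg Subtype.val hv)

/-- The divisor class group of a torus is trivial. -/
lemma exists_ord_eq_on_torus (D : WeilDivisor (F.toricVariety K)) :
    ∃ g : (F.toricVariety K).functionField, g ≠ 0 ∧ ∀ p hp,
      D ⟨F.chart K F.botCone p, hp⟩ = (F.toricVariety K).ord g (F.chart K F.botCone p) := by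
  classical
  induction D using Finsupp.induction_linear with
  | zero => exact ⟨1, one_ne_zero, fun p hp => (ord_one _ _).symm⟩
  | add D E hD hE =>
    obtain ⟨g, hg, hD⟩ := hD
    obtain ⟨h, hh, hE⟩ := hE
    refine ⟨g * h, mul_ne_zero hg hh, fun p hp => ?_⟩
    rw [Finsupp.add_apply, hD, hE, Scheme.ord_mul hg hh]
  | single x n =>
    obtain ⟨x, hx⟩ := x
    by_cases hxT : ∃ p : affineToric K F.botCone.1, F.chart K F.botCone p = x
    · obtain ⟨p, rfl⟩ := hxT
      have hp1 : p.asIdeal.height = 1 := by rw [height_eq_coheight (F.chart K F.botCone), hx]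
      have : p.asIdeal.IsPrime := p.2
      -- In a UFD a prime of height one is generated by a prime element `a`. On the torus `div a` is
      -- that single prime divisor, since no other height-one prime contains `a`.
      obtain ⟨a, ha, hprime⟩ := Ideal.IsPrime.exists_mem_prime_of_ne_bot (p.2)
        (Ideal.ne_bot_of_height_eq_one hp1)
      have hpa := p.asIdeal.eq_span_singleton_of_height_eq_one hp1 ha hprime
      have h0 : F.rat K F.botCone a ≠ 0 :=
        (map_ne_zero_iff _ (F.rat_injective K _)).2 hprime.ne_zero
      have hzpow : ∀ y, (F.toricVariety K).ord (F.rat K F.botCone a ^ n) y =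
          n * (F.toricVariety K).ord (F.rat K F.botCone a) y := by
        intro y
        have := map_zsmul (ordUnits y) n (Additive.ofMul (Units.mk0 _ h0))
        simpa [ordUnits] using this
      refine ⟨F.rat K F.botCone a ^ n, zpow_ne_zero _ h0, fun q hq => ?_⟩
      rw [hzpow]
      by_cases hqp : q = p
      · subst hqp
        have : (F.toricVariety K).ord (F.rat K F.botCone a) (F.chart K F.botCone q) = 1 :=
          ord_toFunctionField_of_span_eq _ hp1 hpa
        rw [Finsupp.single_eq_same, this, mul_one]
      · have hq1 : q.asIdeal.height = 1 := by
          rw [height_eq_coheight (F.chart K F.botCone), hq]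
        have : q.asIdeal.IsPrime := q.2
        have haq : a ∉ q.asIdeal := fun h => hqp (PrimeSpectrum.ext
          ((q.asIdeal.eq_span_singleton_of_height_eq_one hq1 h hprime).trans hpa.symm))
        have h1 : (F.toricVariety K).ord (F.rat K F.botCone a) (F.chart K F.botCone q) = 0 :=
          ord_toFunctionField_of_notMem _ haq
        rw [h1, mul_zero, Finsupp.single_eq_of_ne]
        intro h
        exact hqp ((F.chart K F.botCone).isOpenEmbedding.injective (congrArg Subtype.val h))
    · refine ⟨1, one_ne_zero, fun p hp => ?_⟩
      rw [ord_one, Finsupp.single_eq_of_ne]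
      intro h
      exact hxT ⟨p, congrArg Subtype.val h⟩

/-- An irreducible factor of `a` does not divide `b`, so along its divisor `a` has positive order
and `b` has order zero. -/
lemma isUnit_of_ord_eq {a b : coordRing K F.botCone.1} (ha : a ≠ 0) (hab : IsRelPrime a b)
    (h : ∀ p, Order.coheight (F.chart K F.botCone p) = 1 →
      (F.toricVariety K).ord (F.rat K F.botCone a) (F.chart K F.botCone p) =
        (F.toricVariety K).ord (F.rat K F.botCone b) (F.chart K F.botCone p)) : IsUnit a := by
  by_contra hu
  obtain ⟨π, hπ, c, rfl⟩ := WfDvdMonoid.exists_irreducible_factor hu ha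
  have hprime : Prime π := hπ.prime
  have hbπ : ¬ π ∣ b := fun hb => hπ.not_isUnit (hab (dvd_mul_right π c) hb)
  have hI : (Ideal.span {π}).IsPrime := (Ideal.span_singleton_prime hprime.ne_zero).2 hprime
  let p : affineToric K F.botCone.1 := (⟨Ideal.span {π}, hI⟩ : PrimeSpectrum _)
  have hheight : p.asIdeal.height = 1 :=
    height_eq_one_of_eq_span (p := Ideal.span {π}) hprime.ne_zero rfl
  have hne : ∀ d : coordRing K F.botCone.1, d ≠ 0 → F.rat K F.botCone d ≠ 0 := fun d hd =>
    (map_ne_zero_iff _ (F.rat_injective K _)).2 hd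
  have hc : c ≠ 0 := right_ne_zero_of_mul ha
  have h1 := h p (by rw [← height_eq_coheight, hheight])
  have h2 : (F.toricVariety K).ord (F.rat K F.botCone π) (F.chart K F.botCone p) = 1 :=
    ord_toFunctionField_of_span_eq _ hheight rfl
  have h3 : (F.toricVariety K).ord (F.rat K F.botCone b) (F.chart K F.botCone p) = 0 :=
    ord_toFunctionField_of_notMem _ fun hb => hbπ (Ideal.mem_span_singleton.1 hb)
  have h4 : 0 ≤ (F.toricVariety K).ord (F.rat K F.botCone c) (F.chart K F.botCone p) :=
    ord_toFunctionField_nonneg _ p hc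
  rw [map_mul, Scheme.ord_mul (hne _ hprime.ne_zero) (hne _ hc), h2, h3] at h1
  omega

/-- A rational function without zeros and poles on the torus is a multiple of a character. -/
lemma exists_eq_character {g : (F.toricVariety K).functionField} (hg : g ≠ 0)
    (h : ∀ p, Order.coheight (F.chart K F.botCone p) = 1 →
      (F.toricVariety K).ord g (F.chart K F.botCone p) = 0) :
    ∃ m : Module.Dual ℤ N, ∀ x, (F.toricVariety K).ord g x =
      (F.toricVariety K).ord (F.character K m) x := by
  obtain ⟨a, b, hb, rfl⟩ := exists_eq_div_toFunctionField (F.chart K F.botCone) g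
  change coordRing K F.botCone.1 at a b
  -- In lowest terms, equal orders on the torus make both numerator and denominator units, that is,
  -- monomials.
  obtain ⟨a, b, d, hab, rfl, rfl⟩ := UniqueFactorizationMonoid.exists_reduced_factors' a b hb
  have hd : d ≠ 0 := left_ne_zero_of_mul hb
  replace hb : b ≠ 0 := right_ne_zero_of_mul hb
  have hne : ∀ d : coordRing K F.botCone.1, d ≠ 0 → F.rat K F.botCone d ≠ 0 := fun d hd =>
    (map_ne_zero_iff _ (F.rat_injective K _)).2 hd
  have ha : a ≠ 0 := by
    rintro rfl
    simp at hg
  have heq : toFunctionField (F.chart K F.botCone) (d * a) /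
      toFunctionField (F.chart K F.botCone) (d * b) =
        F.rat K F.botCone a / F.rat K F.botCone b := by
    change F.rat K F.botCone (d * a) / F.rat K F.botCone (d * b) = _
    rw [map_mul, map_mul, mul_div_mul_left _ _ (hne d hd)]
  rw [heq] at hg h ⊢
  have hord : ∀ x, (F.toricVariety K).ord (F.rat K F.botCone a) x =
      (F.toricVariety K).ord (F.rat K F.botCone a / F.rat K F.botCone b) x +
        (F.toricVariety K).ord (F.rat K F.botCone b) x := by
    intro x
    rw [← Scheme.ord_mul hg (hne b hb), div_mul_cancel₀ _ (hne b hb)]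
  have hT : ∀ p, Order.coheight (F.chart K F.botCone p) = 1 →
      (F.toricVariety K).ord (F.rat K F.botCone a) (F.chart K F.botCone p) =
        (F.toricVariety K).ord (F.rat K F.botCone b) (F.chart K F.botCone p) := by
    intro p hp
    rw [hord, h p hp, zero_add]
  have hua := F.isUnit_of_ord_eq K ha hab hT
  have hub := F.isUnit_of_ord_eq K hb hab.symm fun p hp => (hT p hp).symm
  have := twoUniqueSums_dualMonoid F.botCone.1
  obtain ⟨m, c, hc, rfl⟩ := exists_eq_single_of_isUnit hua
  obtain ⟨n, e, he, rfl⟩ := exists_eq_single_of_isUnit hub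
  have hsingle : ∀ (k : dualMonoid F.botCone.1) (c : K), c ≠ 0 → ∀ x,
      (F.toricVariety K).ord (F.rat K F.botCone (.single k c)) x =
        F.ordCharacter K x k.1 := by
    intro k c hc x
    have h1 : (.single k c : coordRing K F.botCone.1) = .single k 1 * .single 0 c := by
      rw [AddMonoidAlgebra.single_mul_single, add_zero, one_mul]
    rw [h1, map_mul, Scheme.ord_mul (hne _ (by simp)) (hne _ (by simpa)),
      F.ord_rat_single_zero K hc, add_zero, rat_single]
    rfl
  refine ⟨m.1 - n.1, fun x => ?_⟩
  have h1 := hord x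
  rw [hsingle m c hc, hsingle n e he] at h1
  change _ = F.ordCharacter K x _
  rw [map_sub, h1, add_sub_cancel_right]

/-! ### The presentation of the class group -/

/-- The class in `Cl(X(Σ))` of `∑ c_v D_v`. -/
noncomputable def rayClass : (F.rayGenerators → ℤ) →+ DivisorClassGroup (F.toricVariety K) :=
  (QuotientAddGroup.mk' _).comp (F.rayDivisor K)

/-- Subtracting from `D` the divisor of a function with the same orders on the torus leaves only
multiples of the ray divisors. -/
lemma rayClass_surjective : Function.Surjective (F.rayClass K) := by
  intro y
  obtain ⟨D, rfl⟩ := QuotientAddGroup.mk'_surjective _ y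
  obtain ⟨g, hg, hD⟩ := F.exists_ord_eq_on_torus K D
  refine ⟨fun v => D ⟨F.rayPoint K v, F.coheight_rayPoint K v⟩ -
    (F.toricVariety K).ord g (F.rayPoint K v), ?_⟩
  refine QuotientAddGroup.eq.2 ⟨g, hg, ?_⟩
  rintro ⟨x, hx⟩
  rw [Finsupp.add_apply, Finsupp.neg_apply]
  rcases F.exists_chart_or_rayPoint K hx with ⟨p, rfl⟩ | ⟨v, rfl⟩
  · rw [rayDivisor_chart, hD, neg_zero, zero_add]
  · rw [rayDivisor_rayPoint, neg_sub, sub_add_cancel]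

/-- A function whose divisor misses the torus has the divisor of a character, and the orders of that
character along the rays are the values `m v`. -/
lemma rayClass_eq_zero_iff (c : F.rayGenerators → ℤ) :
    F.rayClass K c = 0 ↔ ∃ m : Module.Dual ℤ N, ∀ v, c v = m v.1 := by
  have h0 : F.rayClass K c = 0 ↔ F.rayDivisor K c ∈ principalDivisors (F.toricVariety K) :=
    QuotientAddGroup.eq_zero_iff _
  rw [h0]
  constructor
  · rintro ⟨g, hg, h⟩
    obtain ⟨m, hm⟩ := F.exists_eq_character K hg fun p hp => by
      rw [← h ⟨_, hp⟩, rayDivisor_chart]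
    refine ⟨m, fun v => ?_⟩
    rw [← F.rayDivisor_rayPoint K c v, h, hm, ord_character_rayPoint]
  · rintro ⟨m, hm⟩
    refine ⟨F.character K m, F.character_ne_zero K m, ?_⟩
    rintro ⟨x, hx⟩
    rcases F.exists_chart_or_rayPoint K hx with ⟨p, rfl⟩ | ⟨v, rfl⟩
    · rw [rayDivisor_chart, ord_character_torus]
    · rw [rayDivisor_rayPoint, ord_character_rayPoint, hm]

end Fan

end Toric

theorem mainTheorem12 {K : Type u} [Field K] [IsAlgClosed K] [CharZero K]
    {N : Type u} [AddCommGroup N] [Module.Free ℤ N] [Module.Finite ℤ N]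
    (F : Toric.Fan N) (hF : F.IsNondegenerate) :
    Nonempty (AddCommGroup.torsion (Toric.DivisorClassGroup (F.toricVariety K)) ≃+
      N ⧸ F.raySublattice) := by
  have h := Toric.nonempty_torsion_addEquiv (fun v : F.rayGenerators => v.1) (F.rayClass K)
    (F.rayClass_surjective K) (F.rayClass_eq_zero_iff K)
    fun m hm => F.eq_zero_of_forall_ray hF fun ρ hρ v hv => hm ⟨v, ρ, hρ, hv⟩
  rw [Subtype.range_coe] at h
  exact h
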